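/- For an integer $n$ let $T_{2n}$ be the twist knot with $2$ left-handed vertical crossings and $2n$ right-handed horizontal crossings (for $n<0$: $2|n|$ left-handed horizontal crossings); so $T_0$ is the unknot, $T_2$ the figure-eight knot and $T_{-2}$ the right-handed trefoil. The A-polynomial of a knot is the polynomial in $\mathbb Z[L,M]$, unique up to sign, which has no repeated factors and whose coefficients have no common factor, and which is, up to a constant, the product of the defining polynomials of the irreducible curves contained in the Zariski closure in $\mathbb C^2$ of the set of pairs $(L,M)$ of upper left entries of $\rho(\lambda)$ and $\rho(\mu)$; here $\mu$ is a meridian, $\lambda$ the corresponding preferred longitude, and $\rho$ runs over the non-abelian representations of the knot group in $\mathrm{SL}(2,\mathbb C)$ for which $\rho(\mu)$ and $\rho(\lambda)$ are upper triangular (so the factor $L-1$ of the abelian representations is left out). **Theorem.** With a suitable choice of signs, the A-polynomials $A_{2n}=A_{2n}(L,M)$ of the knots $T_{2n}$, $n\in\mathbb Z$, are given recursively by $$A_{2n}=\begin{cases}A_u\,A_{2(n-1)}-M^4(1+LM^2)^4A_{2(n-2)} & \text{if } n>1,\\ A_u\,A_{2(n+1)}-M^4(1+LM^2)^4A_{2(n+2)}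 & \text{if } n<-2,\end{cases}$$ with initial conditions $$\begin{aligned} A_{-4}&=1-L+2LM^2+2LM^4+L^2M^4-L^2M^6-LM^8+LM^{10}+2L^2M^{10}+2L^2M^{12}-L^2M^{14}+L^3M^{14},\\ A_{-2}&=1+LM^6,\\ A_0&=-1,\\ A_2&=L-LM^2-M^4-2LM^4-L^2M^4-LM^6+LM^8, \end{aligned}$$ where $$A_u=1-L+2LM^2+M^4+2LM^4+L^2M^4+2LM^6-LM^8+L^2M^8.$$ -/

import Mathlib

open MvPolynomial

/-- An oriented knot diagram, recorded by its signed Gauss code.  Starting at a base point one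
travels once along the knot and meets the crossings in `len` successive passages, numbered
`0, 1, …, len - 1` (cyclically); every crossing is met exactly twice, once on the upper and once
on the lower strand. -/
structure KnotDiagram where
  /-- the number of passages, that is, twice the number of crossings -/
  len : ℕ
  len_pos : NeZero len
  /-- the other passage through the same crossing -/
  partner : Fin len → Fin len
  /-- whether the passage runs along the upper strand -/
  isOver : Fin len → Bool
  /-- the sign of the crossing that is met -/
  sign : Fin len → ℤˣ
  partner_partner : ∀ i, partner (partner i) = i
  isOver_partner : ∀ i, isOver (partner i) = !isOver i
  sign_partner : ∀ i, sign (partner i) = sign i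

namespace KnotDiagram

attribute [instance] KnotDiagram.len_pos

/-- The generator `x i` of the Wirtinger presentation is the meridian (oriented by the right-hand
rule) of the edge of the diagram that leads into passage `i`; the edge that leads out of passage
`i` is edge `i + 1`.  `under D i` is what a path parallel to the knot picks up in passage `i`:
nothing on an upper strand, and the `±1`-st power of the meridian of the upper strand, with the
sign of the crossing, on a lower strand. -/
def under (D : KnotDiagram) (i : Fin D.len) : FreeGroup (Fin D.len) :=
  if D.isOver i then 1 else FreeGroup.of (D.partner i) ^ ((D.sign i : ℤ))

/-- The Wirtinger relators: `x (i + 1) = (under i)⁻¹ * x i * under i`.  (So the generator does not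
change in an upper passage, and is conjugated by that of the upper strand in a lower one.) -/
def relators (D : KnotDiagram) : Set (FreeGroup (Fin D.len)) :=
  Set.range fun i : Fin D.len =>
    (FreeGroup.of (i + 1))⁻¹ * ((D.under i)⁻¹ * FreeGroup.of i * D.under i)

/-- The knot group, i.e. the fundamental group of the knot exterior, by its Wirtinger
presentation. -/
abbrev Grp (D : KnotDiagram) : Type := PresentedGroup D.relators

/-- The meridian at the base point. -/
def meridian (D : KnotDiagram) : D.Grp := PresentedGroup.of 0

/-- The writhe: the sum of the signs of the crossings, each counted at its lower passage. -/
def writhe (D : KnotDiagram) : ℤ := ∑ i, if D.isOver i then 0 else (D.sign i : ℤ)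

/-- The preferred (null-homologous) longitude at the base point, read off along the knot; it
commutes with `meridian`. -/
def longitude (D : KnotDiagram) : D.Grp :=
  PresentedGroup.mk D.relators (List.ofFn D.under).prod * D.meridian ^ (-D.writhe)

/-- The points `(L, M)` where `L` and `M` are the upper left entries of the images of the longitude
and of the meridian under a non-abelian representation of the knot group in `SL(2, ℂ)` that sends
both of them to upper triangular matrices. -/
def eigenvaluePairs (D : KnotDiagram) : Set (Fin 2 → ℂ) :=
  {p | ∃ ρ : D.Grp →* Matrix.SpecialLinearGroup (Fin 2) ℂ,
    (∃ a b, ρ a * ρ b ≠ ρ b * ρ a) ∧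
    (ρ D.longitude : Matrix (Fin 2) (Fin 2) ℂ) 1 0 = 0 ∧
    (ρ D.meridian : Matrix (Fin 2) (Fin 2) ℂ) 1 0 = 0 ∧
    (ρ D.longitude : Matrix (Fin 2) (Fin 2) ℂ) 0 0 = p 0 ∧
    (ρ D.meridian : Matrix (Fin 2) (Fin 2) ℂ) 0 0 = p 1}

/-- The Zariski closure of `eigenvaluePairs` in the affine plane. -/
def eigenvalueVariety (D : KnotDiagram) : Set (Fin 2 → ℂ) :=
  zeroLocus ℂ (vanishingIdeal ℂ D.eigenvaluePairs)

/-- `P ∈ ℤ[L, M]`, with `L = X 0` and `M = X 1`, is the A-polynomial of the knot: the product of the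
defining polynomials of the irreducible curves that lie in the eigenvalue variety, each taken once,
normalised to have integer coefficients without a common factor (this determines `P` up to sign).
The factor `L - 1` of the abelian representations is left out. -/
structure IsAPolynomial (D : KnotDiagram) (P : MvPolynomial (Fin 2) ℤ) : Prop where
  primitive : ∀ c : ℤ, C c ∣ P → IsUnit c
  squarefree : Squarefree (map (Int.castRingHom ℂ) P)
  dvd_iff : ∀ f : MvPolynomial (Fin 2) ℂ, Irreducible f →
    (f ∣ map (Int.castRingHom ℂ) P ↔ {p | eval p f = 0} ⊆ D.eigenvalueVariety)

end KnotDiagram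

/-- The passages through the two vertical crossings of the diagram with `K` horizontal ones. -/
abbrev IsClasp (K i : ℕ) : Prop := i < 2 ∨ i = K + 2 ∨ i = K + 3

/-- The twist knot `T_{2n}`, with two left-handed vertical crossings `v₁` (top), `v₂` (bottom) and
`2n` right-handed horizontal crossings `h₁, …, h_K` (from left to right), `K = 2|n|`; for negative
`n` this means `K` left-handed horizontal crossings.  The tangle of the vertical crossings stands to
the left of that of the horizontal ones, the right-hand ends of the former are joined to the
left-hand ends of the latter, and the two remaining upper ends, and the two remaining lower ends,
are joined by arcs.

Starting at the upper left end of the vertical tangle, going down, one meets the crossings in the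
order `v₁, v₂, h_K, …, h₁, v₂, v₁, h₁, …, h_K`.  For `n > 0` the diagram is alternating, beginning
with an upper passage; for `n < 0` the horizontal crossings are changed.  A crossing in a twist is
right-handed if it is positive for parallel orientations of its two strands; here the strands run
antiparallel through both twists, so that left-handed crossings are positive and right-handed ones
negative. -/
def twistKnot (n : ℤ) : KnotDiagram where
  len := 2 * (2 * n.natAbs) + 4
  len_pos := ⟨by omega⟩
  partner i :=
    if h : IsClasp (2 * n.natAbs) i then
      ⟨2 * n.natAbs + 3 - i, by omega⟩
    else
      ⟨2 * (2 * n.natAbs) + 5 - i, by have := i.2; simp only [IsClasp] at h; omega⟩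
  isOver i :=
    if IsClasp (2 * n.natAbs) i ∨ 0 ≤ n then decide (Even (i : ℕ)) else !decide (Even (i : ℕ))
  sign i := if IsClasp (2 * n.natAbs) i ∨ n ≤ 0 then 1 else -1
  partner_partner i := by
    have hi := i.2
    apply Fin.ext
    by_cases h : IsClasp (2 * n.natAbs) i
    · have h' : IsClasp (2 * n.natAbs) (2 * n.natAbs + 3 - i) := by
        simp only [IsClasp] at h ⊢; omega
      simp only [h, h', dite_true]
      simp only [IsClasp] at h; omega
    · have h' : ¬ IsClasp (2 * n.natAbs) (2 * (2 * n.natAbs) + 5 - i) := by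
        simp only [IsClasp] at h ⊢; omega
      simp only [h, h', dite_false]
      simp only [IsClasp] at h; omega
  isOver_partner i := by
    have hi := i.2
    by_cases h : IsClasp (2 * n.natAbs) i
    · have h' : IsClasp (2 * n.natAbs) (2 * n.natAbs + 3 - i) := by
        simp only [IsClasp] at h ⊢; omega
      have e : Even (2 * n.natAbs + 3 - (i : ℕ)) ↔ ¬ Even (i : ℕ) := by
        simp only [IsClasp] at h; simp only [Nat.even_iff]; omega
      simp [h, h', e, -Nat.not_even_iff_odd]
    · have h' : ¬ IsClasp (2 * n.natAbs) (2 * (2 * n.natAbs) + 5 - i) := by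
        simp only [IsClasp] at h ⊢; omega
      have e : Even (2 * (2 * n.natAbs) + 5 - (i : ℕ)) ↔ ¬ Even (i : ℕ) := by
        simp only [IsClasp] at h; simp only [Nat.even_iff]; omega
      by_cases hn : 0 ≤ n <;> simp [h, h', e, hn, -Nat.not_even_iff_odd]
  sign_partner i := by
    have hi := i.2
    by_cases h : IsClasp (2 * n.natAbs) i
    · have h' : IsClasp (2 * n.natAbs) (2 * n.natAbs + 3 - i) := by
        simp only [IsClasp] at h ⊢; omega
      simp [h, h']
    · have h' : ¬ IsClasp (2 * n.natAbs) (2 * (2 * n.natAbs) + 5 - i) := by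
        simp only [IsClasp] at h ⊢; omega
      simp [h, h']

namespace TwistKnot

/-- The variable `L` of `ℤ[L, M]`. -/
noncomputable abbrev L : MvPolynomial (Fin 2) ℤ := X 0

/-- The variable `M` of `ℤ[L, M]`. -/
noncomputable abbrev M : MvPolynomial (Fin 2) ℤ := X 1

/-- The polynomial `A_u`. -/
noncomputable def Au : MvPolynomial (Fin 2) ℤ :=
  1 - L + 2 * L * M ^ 2 + M ^ 4 + 2 * L * M ^ 4 + L ^ 2 * M ^ 4 + 2 * L * M ^ 6 - L * M ^ 8
    + L ^ 2 * M ^ 8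

end TwistKnot

open TwistKnot

/-! The group of `T_{2n}` is generated by two meridians `a`, `c`. With `p = c⁻¹ * a * c` and `w =
p⁻¹ * a`, a commutator that does not involve `n`, the only relation is `c = w ^ n * p * (w ^ n)⁻¹`,
and the longitude is a word in `a`, `c`, `w ^ n` (`hom_relation`, `exists_hom`).

For an irreducible representation normalise `a` to be upper and `c` to be lower triangular, with
eigenvalues `M`, `m = M⁻¹`, and put `z = M² + m²`, `u = tr (a * c⁻¹) - 2`. By Cayley–Hamilton, `w ^
n` is a combination of `w` and `1` with Chebyshev coefficients in `τ = tr w = 2 + u (u + 2 - z)`, so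
the relation becomes one equation `riley n u z = 0`, and these polynomials satisfy `R (n + 2) = τ R
(n + 1) - R n`. The longitude gives `L (1 - M² - u M²) = 1 - M² + u`, again free of `n`. This is a
Möbius relation between `L` and `u`, with `u = (1 - M²)(L - 1) / (1 + L M²)`. Substituting it and
clearing denominators turns the Chebyshev recursion into that of the theorem: `A_u = M² (1 + L M²)²
τ`, and the other coefficient is the square of `M² (1 + L M²)²` (`aPoly_eq_rileyMonic`).

It remains to see that the sequence `aPoly` so defined consists of A-polynomials. At `M² = -1`, the
dihedral representations, the Riley polynomial becomes a geometric sum with simple zeros; hence its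
discriminant is not identically zero, and a repeated factor of `aPoly` would have to be a line `M =
const`, which is excluded (`squarefree_aPoly`). By the Nullstellensatz an irreducible curve lies in
the eigenvalue variety iff its equation divides every polynomial vanishing on the eigenvalue pairs.
Almost every zero of `aPoly` on each of its components is an eigenvalue pair (`dvd_of_dvd_aPoly`),
and all but finitely many eigenvalue pairs are zeros of `aPoly` (`dvd_aPoly_of_forall`). -/

namespace KnotDiagram

/-! ### Wirtinger colourings and homomorphisms from the knot group. -/

variable {H : Type*} [Group H]

/-- The edge leading into passage `i`, counted cyclically. -/
def edge (D : KnotDiagram) (i : ℕ) : Fin D.len := Fin.ofNat D.len i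

theorem edge_add_one (D : KnotDiagram) (i : ℕ) : D.edge (i + 1) = D.edge i + 1 := by
  apply Fin.ext
  simp [edge, Fin.val_add]

theorem edge_val (D : KnotDiagram) (i : Fin D.len) : D.edge i = i := by
  simp [edge]

/-- The image of `under D i` under the homomorphism that sends the generators to `x`. -/
def pick (D : KnotDiagram) (x : Fin D.len → H) (i : Fin D.len) : H :=
  if D.isOver i then 1 else x (D.partner i) ^ ((D.sign i : ℤ))

/-- The assignment `x` of group elements to the edges satisfies the Wirtinger relations. -/
def IsColoring (D : KnotDiagram) (x : Fin D.len → H) : Prop :=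
  ∀ i, x (i + 1) = (D.pick x i)⁻¹ * x i * D.pick x i

theorem lift_under (D : KnotDiagram) (x : Fin D.len → H) (i : Fin D.len) :
    FreeGroup.lift x (D.under i) = D.pick x i := by
  unfold under pick
  split_ifs <;> simp

theorem isColoring_of_hom (D : KnotDiagram) (ρ : D.Grp →* H) :
    D.IsColoring fun i => ρ (PresentedGroup.of i) := by
  intro i
  have h : ρ.comp (PresentedGroup.mk D.relators) =
      FreeGroup.lift fun i => ρ (PresentedGroup.of i) := by
    ext j; simp [PresentedGroup.of]
  have h1 : PresentedGroup.mk D.relators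
      ((FreeGroup.of (i + 1))⁻¹ * ((D.under i)⁻¹ * FreeGroup.of i * D.under i)) = 1 :=
    PresentedGroup.one_of_mem ⟨i, rfl⟩
  have h2 := congrArg ρ h1
  rw [← MonoidHom.comp_apply, h, map_one] at h2
  simp only [map_mul, map_inv, lift_under, FreeGroup.lift_apply_of] at h2
  exact inv_mul_eq_one.1 h2

/-- The homomorphism from the knot group given by a colouring. -/
def IsColoring.hom {D : KnotDiagram} {x : Fin D.len → H} (h : D.IsColoring x) : D.Grp →* H :=
  PresentedGroup.toGroup (f := x) <| by
    rintro _ ⟨i, rfl⟩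
    simp only [map_mul, map_inv, lift_under, FreeGroup.lift_apply_of]
    exact inv_mul_eq_one.2 (h i)

theorem IsColoring.hom_of {D : KnotDiagram} {x : Fin D.len → H} (h : D.IsColoring x)
    (i : Fin D.len) : h.hom (PresentedGroup.of i) = x i := by
  simp [IsColoring.hom]

theorem hom_longitude (D : KnotDiagram) (ρ : D.Grp →* H) :
    ρ D.longitude = (List.ofFn (D.pick fun i => ρ (PresentedGroup.of i))).prod *
      ρ D.meridian ^ (-D.writhe) := by
  have h : ρ.comp (PresentedGroup.mk D.relators) =
      FreeGroup.lift fun i => ρ (PresentedGroup.of i) := by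
    ext j; simp [PresentedGroup.of]
  unfold longitude
  rw [map_mul, map_zpow, ← MonoidHom.comp_apply, h, map_list_prod, List.map_ofFn]
  congr 3
  ext i
  simp [lift_under]

theorem hom_commute_of_forall_eq (D : KnotDiagram) (ρ : D.Grp →* H) (a : H)
    (h : ∀ i, ρ (PresentedGroup.of i) = a) (g g' : D.Grp) : ρ g * ρ g' = ρ g' * ρ g := by
  have key : ∀ g, ρ g ∈ Subgroup.zpowers a := by
    intro g
    have : (⊤ : Subgroup D.Grp) ≤ (Subgroup.zpowers a).comap ρ := by
      rw [← PresentedGroup.closure_range_of, Subgroup.closure_le]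
      rintro _ ⟨i, rfl⟩
      simp [h]
    exact this (Subgroup.mem_top g)
  obtain ⟨i, hi⟩ := key g
  obtain ⟨j, hj⟩ := key g'
  simp only [← hi, ← hj]
  exact (Commute.refl a).zpow_zpow i j

theorem prod_ofFn_eq_prod_range {H : Type*} [Monoid H] (N : ℕ) (u : ℕ → H) :
    (List.ofFn fun i : Fin N => u i).prod = ((List.range N).map u).prod := by
  congr 1
  apply List.ext_getElem <;> simp

end KnotDiagram

open KnotDiagram

/-! ### Colourings of the twist knot diagram. -/

namespace TwistKnot

variable {H : Type*} [Group H]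

theorem len_twistKnot (n : ℤ) : (twistKnot n).len = 4 * n.natAbs + 4 := by
  simp only [twistKnot]; ring

theorem val_edge {n : ℤ} {i : ℕ} (h : i < 4 * n.natAbs + 4) :
    ((twistKnot n).edge i : ℕ) = i := by
  rw [edge, Fin.val_ofNat, Nat.mod_eq_of_lt (by rwa [len_twistKnot])]

theorem edge_len (n : ℤ) : (twistKnot n).edge (4 * n.natAbs + 4) = (twistKnot n).edge 0 := by
  rw [← len_twistKnot]; simp [edge]

theorem partner_clasp {n : ℤ} {i j : ℕ} (hi : IsClasp (2 * n.natAbs) i)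
    (hj : i + j = 2 * n.natAbs + 3) :
    (twistKnot n).partner ((twistKnot n).edge i) = (twistKnot n).edge j := by
  have h1 := val_edge (n := n) (i := i) (by omega)
  apply Fin.ext
  rw [val_edge (by omega)]
  simp only [twistKnot] at h1 ⊢
  simp only [h1, hi, dite_true]
  omega

theorem partner_twist {n : ℤ} {i j : ℕ} (hi : ¬ IsClasp (2 * n.natAbs) i)
    (hl : i < 4 * n.natAbs + 4)
    (hj : i + j = 4 * n.natAbs + 5) :
    (twistKnot n).partner ((twistKnot n).edge i) = (twistKnot n).edge j := by
  have h1 := val_edge (n := n) (i := i) (by omega)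
  apply Fin.ext
  rw [val_edge (by simp only [IsClasp] at hi; omega)]
  simp only [twistKnot] at h1 ⊢
  simp only [h1, hi, dite_false]
  omega

theorem pick_clasp_even {n : ℤ} (x : Fin (twistKnot n).len → H) {i : ℕ}
    (hi : IsClasp (2 * n.natAbs) i) (he : Even i) :
    (twistKnot n).pick x ((twistKnot n).edge i) = 1 := by
  have h1 := val_edge (n := n) (i := i) (by simp only [IsClasp] at hi; omega)
  have : (twistKnot n).isOver ((twistKnot n).edge i) = true := by
    simp only [twistKnot] at h1 ⊢
    simp [h1, hi, he]
  simp [pick, this]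

theorem pick_clasp_odd {n : ℤ} (x : Fin (twistKnot n).len → H) {i j : ℕ}
    (hi : IsClasp (2 * n.natAbs) i) (he : Odd i) (hj : i + j = 2 * n.natAbs + 3) :
    (twistKnot n).pick x ((twistKnot n).edge i) = x ((twistKnot n).edge j) := by
  have h1 := val_edge (n := n) (i := i) (by omega)
  have : (twistKnot n).isOver ((twistKnot n).edge i) = false := by
    simp only [twistKnot] at h1 ⊢
    simp [h1, hi, he]
  have h2 : (twistKnot n).sign ((twistKnot n).edge i) = 1 := by
    simp only [twistKnot] at h1 ⊢
    simp [h1, hi]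
  simp [pick, this, h2, partner_clasp hi hj]

theorem pick_pos_even {n : ℤ} (hn : 0 ≤ n) (x : Fin (twistKnot n).len → H) {i : ℕ}
    (hl : i < 4 * n.natAbs + 4) (he : Even i) :
    (twistKnot n).pick x ((twistKnot n).edge i) = 1 := by
  have h1 := val_edge (n := n) (i := i) hl
  have : (twistKnot n).isOver ((twistKnot n).edge i) = true := by
    simp only [twistKnot] at h1 ⊢
    simp [h1, hn, he]
  simp [pick, this]

theorem pick_pos_odd {n : ℤ} (hn : 0 ≤ n) (x : Fin (twistKnot n).len → H) {i j : ℕ}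
    (hi : ¬ IsClasp (2 * n.natAbs) i) (hl : i < 4 * n.natAbs + 4) (he : Odd i)
    (hj : i + j = 4 * n.natAbs + 5) :
    (twistKnot n).pick x ((twistKnot n).edge i) = (x ((twistKnot n).edge j))⁻¹ := by
  have h1 := val_edge (n := n) (i := i) hl
  have : (twistKnot n).isOver ((twistKnot n).edge i) = false := by
    simp only [twistKnot] at h1 ⊢
    simp [h1, hn, he]
  have h0 : ¬ n ≤ 0 := by simp only [IsClasp] at hi; omega
  have h2 : (twistKnot n).sign ((twistKnot n).edge i) = -1 := by
    simp only [twistKnot] at h1 ⊢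
    simp [h1, hi, h0]
  simp [pick, this, h2, partner_twist hi hl hj]

theorem pick_neg_odd {n : ℤ} (hn : n < 0) (x : Fin (twistKnot n).len → H) {i : ℕ}
    (hi : ¬ IsClasp (2 * n.natAbs) i) (hl : i < 4 * n.natAbs + 4) (he : Odd i) :
    (twistKnot n).pick x ((twistKnot n).edge i) = 1 := by
  have h1 := val_edge (n := n) (i := i) hl
  have : (twistKnot n).isOver ((twistKnot n).edge i) = true := by
    simp only [twistKnot] at h1 ⊢
    simp [h1, hi, he, hn]
  simp [pick, this]

theorem pick_neg_even {n : ℤ} (hn : n < 0) (x : Fin (twistKnot n).len → H) {i j : ℕ}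
    (hi : ¬ IsClasp (2 * n.natAbs) i) (hl : i < 4 * n.natAbs + 4) (he : Even i)
    (hj : i + j = 4 * n.natAbs + 5) :
    (twistKnot n).pick x ((twistKnot n).edge i) = x ((twistKnot n).edge j) := by
  have h1 := val_edge (n := n) (i := i) hl
  have : (twistKnot n).isOver ((twistKnot n).edge i) = false := by
    simp only [twistKnot] at h1 ⊢
    simp [h1, hi, he, hn]
  have h2 : (twistKnot n).sign ((twistKnot n).edge i) = 1 := by
    simp only [twistKnot] at h1 ⊢
    simp [h1, hn.le]
  simp [pick, this, h2, partner_twist hi hl hj]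

theorem edge_succ {n : ℤ} {x : Fin (twistKnot n).len → H} (hx : (twistKnot n).IsColoring x)
    (i : ℕ) : x ((twistKnot n).edge (i + 1)) =
      ((twistKnot n).pick x ((twistKnot n).edge i))⁻¹ * x ((twistKnot n).edge i) *
        (twistKnot n).pick x ((twistKnot n).edge i) := by
  rw [edge_add_one]; exact hx _

/-- The colours of the edges of both strands of the horizontal twist, for `0 ≤ n`. -/
theorem coloring_twist_of_nonneg {n : ℤ} (hn : 0 ≤ n) {x : Fin (twistKnot n).len → H}
    (hx : (twistKnot n).IsColoring x) {p w : H} (hp : x ((twistKnot n).edge 2) = p)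
    (hq : x ((twistKnot n).edge (4 * n.natAbs + 4)) = p * w) (k : ℕ) (hk : k ≤ n.natAbs) :
    x ((twistKnot n).edge (2 + 2 * k)) = w ^ k * p * (w ^ k)⁻¹ ∧
    x ((twistKnot n).edge (4 * n.natAbs + 4 - 2 * k)) = w ^ k * (p * w) * (w ^ k)⁻¹ := by
  -- `w` is the class of a loop around both strands of the twist. It is unchanged along the twist,
  -- and every two crossings conjugate both colours by it.
  induction k with
  | zero => simp [hp, hq]
  | succ k ih =>
    obtain ⟨h1, h2⟩ := ih (by omega)
    have e1 := edge_succ hx (2 + 2 * k)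
    rw [pick_pos_even hn x (by omega) (by simp [parity_simps])] at e1
    have e2 := edge_succ hx (4 * n.natAbs + 4 - 2 * k - 1)
    rw [pick_pos_odd hn x (j := 2 + 2 * k) (by simp only [IsClasp]; omega) (by omega)
      (by rw [Nat.odd_iff]; omega) (by omega),
      show 4 * n.natAbs + 4 - 2 * k - 1 + 1 = 4 * n.natAbs + 4 - 2 * k by omega] at e2
    have e3 := edge_succ hx (4 * n.natAbs + 4 - 2 * (k + 1))
    rw [pick_pos_even hn x (by omega) (by rw [Nat.even_iff]; omega),
      show 4 * n.natAbs + 4 - 2 * (k + 1) + 1 = 4 * n.natAbs + 4 - 2 * k - 1 by omega] at e3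
    have e4 := edge_succ hx (2 + 2 * k + 1)
    rw [pick_pos_odd hn x (j := 4 * n.natAbs + 4 - 2 * (k + 1)) (by simp only [IsClasp]; omega)
      (by omega) (by simp [parity_simps]) (by omega),
      show 2 + 2 * k + 1 + 1 = 2 + 2 * (k + 1) by omega] at e4
    simp only [inv_one, one_mul, mul_one, inv_inv] at e1 e2 e3 e4
    have h3 : x ((twistKnot n).edge (4 * n.natAbs + 4 - 2 * (k + 1))) =
        w ^ (k + 1) * (p * w) * (w ^ (k + 1))⁻¹ := by
      rw [← e3, ← mul_left_cancel_iff (a := x ((twistKnot n).edge (2 + 2 * k))),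
        ← mul_right_cancel_iff (a := (x ((twistKnot n).edge (2 + 2 * k)))⁻¹), ← e2, h1, h2]
      group
    refine ⟨?_, h3⟩
    rw [e4, h3, e1, h1]
    group

/-- The colours of the edges of both strands of the horizontal twist, for `n < 0`. -/
theorem coloring_twist_of_neg {n : ℤ} (hn : n < 0) {x : Fin (twistKnot n).len → H}
    (hx : (twistKnot n).IsColoring x) {p w : H} (hp : x ((twistKnot n).edge 2) = p)
    (hq : x ((twistKnot n).edge (4 * n.natAbs + 4)) = p * w) (k : ℕ) (hk : k ≤ n.natAbs) :
    x ((twistKnot n).edge (2 + 2 * k)) = (w ^ k)⁻¹ * p * w ^ k ∧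
    x ((twistKnot n).edge (4 * n.natAbs + 4 - 2 * k)) = (w ^ k)⁻¹ * (p * w) * w ^ k := by
  induction k with
  | zero => simp [hp, hq]
  | succ k ih =>
    obtain ⟨h1, h2⟩ := ih (by omega)
    have e2 := edge_succ hx (4 * n.natAbs + 4 - 2 * k - 1)
    rw [pick_neg_odd hn x (by simp only [IsClasp]; omega) (by omega)
      (by rw [Nat.odd_iff]; omega),
      show 4 * n.natAbs + 4 - 2 * k - 1 + 1 = 4 * n.natAbs + 4 - 2 * k by omega] at e2
    have e1 := edge_succ hx (2 + 2 * k)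
    rw [pick_neg_even hn x (j := 4 * n.natAbs + 4 - 2 * k - 1) (by simp only [IsClasp]; omega)
      (by omega) (by simp [parity_simps]) (by omega)] at e1
    have e4 := edge_succ hx (2 + 2 * k + 1)
    rw [pick_neg_odd hn x (by simp only [IsClasp]; omega)
      (by omega) (by simp [parity_simps]),
      show 2 + 2 * k + 1 + 1 = 2 + 2 * (k + 1) by omega] at e4
    have e3 := edge_succ hx (4 * n.natAbs + 4 - 2 * (k + 1))
    rw [pick_neg_even hn x (j := 2 + 2 * k + 1) (by simp only [IsClasp]; omega) (by omega)
      (by rw [Nat.even_iff]; omega) (by omega),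
      show 4 * n.natAbs + 4 - 2 * (k + 1) + 1 = 4 * n.natAbs + 4 - 2 * k - 1 by omega] at e3
    simp only [inv_one, one_mul, mul_one] at e1 e2 e3 e4
    have h3 : x ((twistKnot n).edge (2 + 2 * (k + 1))) =
        (w ^ (k + 1))⁻¹ * p * w ^ (k + 1) := by
      rw [e4, e1, ← e2, h1, h2]
      group
    refine ⟨h3, ?_⟩
    rw [← e4, h3] at e3
    rw [← mul_left_cancel_iff (a := ((w ^ (k + 1))⁻¹ * p * w ^ (k + 1))⁻¹),
      ← mul_right_cancel_iff (a := (w ^ (k + 1))⁻¹ * p * w ^ (k + 1)), ← e3, ← e2, h2]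
    group

/-! ### The longitude and the two-generator form of the group. -/

/-- The product of the group elements picked up in the first `i` passages. -/
def pickProd (n : ℤ) (x : Fin (twistKnot n).len → H) (i : ℕ) : H :=
  ((List.range i).map fun j => (twistKnot n).pick x ((twistKnot n).edge j)).prod

theorem pickProd_succ (n : ℤ) (x : Fin (twistKnot n).len → H) (i : ℕ) :
    pickProd n x (i + 1) = pickProd n x i * (twistKnot n).pick x ((twistKnot n).edge i) :=
  List.prod_range_succ _ _

theorem pickProd_two (n : ℤ) (x : Fin (twistKnot n).len → H) :
    pickProd n x 2 = x ((twistKnot n).edge (2 * n.natAbs + 2)) := by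
  rw [pickProd_succ, pickProd_succ, pick_clasp_even x (Or.inl (by omega)) (by simp),
    pick_clasp_odd (j := 2 * n.natAbs + 2) x (Or.inl (by omega)) (by simp) (by omega)]
  simp [pickProd]

theorem pickProd_clasp (n : ℤ) (x : Fin (twistKnot n).len → H) :
    pickProd n x (2 * n.natAbs + 4) =
      pickProd n x (2 * n.natAbs + 2) * x ((twistKnot n).edge 0) := by
  rw [pickProd_succ, pickProd_succ,
    pick_clasp_even x (Or.inr (Or.inl rfl)) (by simp [parity_simps]),
    pick_clasp_odd (j := 0) x (Or.inr (Or.inr rfl)) (by simp [parity_simps]) (by omega), mul_one]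

/-- Along either strand of the twist the elements picked up are conjugates of a fixed element by
consecutive powers of `w`, so the partial products telescope. -/
theorem pickProd_len_nonneg {n : ℤ} (hn : 0 ≤ n) {x : Fin (twistKnot n).len → H}
    (hx : (twistKnot n).IsColoring x) {p w c : H} (hp : x ((twistKnot n).edge 2) = p)
    (hq : x ((twistKnot n).edge (4 * n.natAbs + 4)) = p * w)
    (hc : x ((twistKnot n).edge (2 * n.natAbs + 2)) = c) :
    pickProd n x (4 * n.natAbs + 4) =
      c * p ^ (-n) * w ^ (-n) * (p * w) * w ^ n * (p * w) ^ (-n) := by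
  have hT := coloring_twist_of_nonneg hn hx hp hq
  have h1 : ∀ k ≤ n.natAbs, pickProd n x (2 + 2 * k) = c * (p ^ k)⁻¹ * (w ^ k)⁻¹ := by
    intro k hk
    induction k with
    | zero => simp [pickProd_two, hc]
    | succ k ih =>
      rw [show 2 + 2 * (k + 1) = 2 + 2 * k + 1 + 1 by omega, pickProd_succ, pickProd_succ,
        ih (by omega), pick_pos_even hn x (by omega) (by simp [parity_simps]),
        pick_pos_odd hn x (j := 4 * n.natAbs + 4 - 2 * (k + 1)) (by simp only [IsClasp]; omega)
        (by omega) (by simp [parity_simps]) (by omega), (hT (k + 1) hk).2]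
      group
  have h2 : ∀ k ≤ n.natAbs, pickProd n x (2 * n.natAbs + 4 + 2 * k) =
      c * p ^ (-n) * w ^ (-n) * (p * w) * w ^ n * ((p * w) ^ k)⁻¹ * w ^ (k - n) := by
    intro k hk
    induction k with
    | zero =>
      rw [mul_zero, add_zero, pickProd_clasp, show 2 * n.natAbs + 2 = 2 + 2 * n.natAbs by omega,
        h1 _ le_rfl, ← edge_len n, hq]
      have : n = (n.natAbs : ℤ) := by omega
      rw [this]
      simp only [Int.natAbs_natCast]
      group
    | succ k ih =>
      have e := (hT (n.natAbs - (k + 1)) (by omega)).1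
      rw [show 2 * n.natAbs + 4 + 2 * (k + 1) = 2 * n.natAbs + 4 + 2 * k + 1 + 1 by omega,
        pickProd_succ, pickProd_succ,
        ih (by omega), pick_pos_even hn x (by omega) (by simp [parity_simps]),
        pick_pos_odd hn x (j := 2 + 2 * (n.natAbs - (k + 1))) (by simp only [IsClasp]; omega)
        (by omega) (by simp [parity_simps]) (by omega), e]
      have e2 : w ^ (n.natAbs - (k + 1)) = w ^ (n - (k + 1)) := by
        rw [← zpow_natCast]; congr 1; omega
      rw [e2, pow_succ' (p * w), mul_inv_rev (p * w), mul_inv_rev p w]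
      generalize (p * w) ^ k = y
      push_cast
      group
  have h3 := h2 _ le_rfl
  rw [show 2 * n.natAbs + 4 + 2 * n.natAbs = 4 * n.natAbs + 4 by omega] at h3
  rw [h3]
  have e2 : (p * w) ^ n.natAbs = (p * w) ^ n := by
    rw [← zpow_natCast]; congr 1; omega
  have e3 : (n.natAbs : ℤ) - n = 0 := by omega
  rw [e2, e3, zpow_neg (p * w)]
  simp

theorem pickProd_len_neg {n : ℤ} (hn : n < 0) {x : Fin (twistKnot n).len → H}
    (hx : (twistKnot n).IsColoring x) {p w c : H} (hp : x ((twistKnot n).edge 2) = p)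
    (hq : x ((twistKnot n).edge (4 * n.natAbs + 4)) = p * w)
    (hc : x ((twistKnot n).edge (2 * n.natAbs + 2)) = c) :
    pickProd n x (4 * n.natAbs + 4) =
      c * p ^ (-n) * w ^ (-n) * (p * w) * w ^ n * (p * w) ^ (-n) := by
  have hT := coloring_twist_of_neg hn hx hp hq
  have hodd : ∀ k, k + 1 ≤ n.natAbs → x ((twistKnot n).edge (2 + 2 * k + 1)) =
      (w ^ (k + 1))⁻¹ * p * w ^ (k + 1) := by
    intro k hk
    have e4 := edge_succ hx (2 + 2 * k + 1)
    rw [pick_neg_odd hn x (by simp only [IsClasp]; omega)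
      (by omega) (by simp [parity_simps]),
      show 2 + 2 * k + 1 + 1 = 2 + 2 * (k + 1) by omega] at e4
    simp only [inv_one, one_mul, mul_one] at e4
    rw [← e4, (hT (k + 1) hk).1]
  have hodd' : ∀ k, k + 1 ≤ n.natAbs → x ((twistKnot n).edge (4 * n.natAbs + 3 - 2 * k)) =
      (w ^ k)⁻¹ * (p * w) * w ^ k := by
    intro k hk
    have e2 := edge_succ hx (4 * n.natAbs + 3 - 2 * k)
    rw [pick_neg_odd hn x (by simp only [IsClasp]; omega) (by omega)
      (by rw [Nat.odd_iff]; omega),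
      show 4 * n.natAbs + 3 - 2 * k + 1 = 4 * n.natAbs + 4 - 2 * k by omega] at e2
    simp only [inv_one, one_mul, mul_one] at e2
    rw [← e2, (hT k (by omega)).2]
  have h1 : ∀ k ≤ n.natAbs, pickProd n x (2 + 2 * k) = c * p ^ k * w ^ k := by
    intro k hk
    induction k with
    | zero => simp [pickProd_two, hc]
    | succ k ih =>
      rw [show 2 + 2 * (k + 1) = 2 + 2 * k + 1 + 1 by omega, pickProd_succ, pickProd_succ,
        ih (by omega), pick_neg_even hn x (j := 4 * n.natAbs + 3 - 2 * k)
          (by simp only [IsClasp]; omega) (by omega) (by simp [parity_simps]) (by omega),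
        pick_neg_odd hn x (by simp only [IsClasp]; omega)
        (by omega) (by simp [parity_simps]), hodd' k hk]
      group
  have h2 : ∀ k ≤ n.natAbs, pickProd n x (2 * n.natAbs + 4 + 2 * k) =
      c * p ^ (-n) * w ^ (-n) * (p * w) * w ^ n * (p * w) ^ k * w ^ (-n - k) := by
    intro k hk
    induction k with
    | zero =>
      rw [mul_zero, add_zero, pickProd_clasp, show 2 * n.natAbs + 2 = 2 + 2 * n.natAbs by omega,
        h1 _ le_rfl, ← edge_len n, hq]
      obtain ⟨m, rfl⟩ : ∃ m : ℕ, n = -m := ⟨n.natAbs, by omega⟩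
      simp only [Int.natAbs_neg, Int.natAbs_natCast]
      group
    | succ k ih =>
      have e := hodd (n.natAbs - (k + 1)) (by omega)
      rw [show n.natAbs - (k + 1) + 1 = n.natAbs - k by omega] at e
      rw [show 2 * n.natAbs + 4 + 2 * (k + 1) = 2 * n.natAbs + 4 + 2 * k + 1 + 1 by omega,
        pickProd_succ, pickProd_succ,
        ih (by omega), pick_neg_even hn x (j := 2 + 2 * (n.natAbs - (k + 1)) + 1)
          (by simp only [IsClasp]; omega)
        (by omega) (by simp [parity_simps]) (by omega),
        pick_neg_odd hn x (by simp only [IsClasp]; omega)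
        (by omega) (by simp [parity_simps]), e]
      have e2 : w ^ (n.natAbs - k) = w ^ (-n - k) := by
        rw [← zpow_natCast]; congr 1; omega
      rw [e2, pow_succ (p * w)]
      generalize (p * w) ^ k = y
      push_cast
      group
  have h3 := h2 _ le_rfl
  rw [show 2 * n.natAbs + 4 + 2 * n.natAbs = 4 * n.natAbs + 4 by omega] at h3
  rw [h3]
  have e2 : (p * w) ^ n.natAbs = (p * w) ^ (-n) := by
    rw [← zpow_natCast]; congr 1; omega
  have e3 : -n - (n.natAbs : ℤ) = 0 := by omega
  rw [e2, e3]
  simp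

theorem edge_zero (n : ℤ) : (twistKnot n).edge 0 = 0 := by
  simp [edge]

theorem coloring_edge_one {n : ℤ} {x : Fin (twistKnot n).len → H}
    (hx : (twistKnot n).IsColoring x) : x ((twistKnot n).edge 1) = x ((twistKnot n).edge 0) := by
  have e := edge_succ hx 0
  rw [pick_clasp_even x (Or.inl (by omega)) (by simp)] at e
  simpa using e

theorem coloring_edge_two {n : ℤ} {x : Fin (twistKnot n).len → H}
    (hx : (twistKnot n).IsColoring x) : x ((twistKnot n).edge 2) =
      (x ((twistKnot n).edge (2 * n.natAbs + 2)))⁻¹ * x ((twistKnot n).edge 0) *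
        x ((twistKnot n).edge (2 * n.natAbs + 2)) := by
  have e := edge_succ hx 1
  rwa [pick_clasp_odd (j := 2 * n.natAbs + 2) x (Or.inl (by omega)) (by simp) (by omega),
    coloring_edge_one hx] at e

theorem coloring_relation {n : ℤ} {x : Fin (twistKnot n).len → H}
    (hx : (twistKnot n).IsColoring x) {p w : H} (hp : x ((twistKnot n).edge 2) = p)
    (hq : x ((twistKnot n).edge 0) = p * w) :
    x ((twistKnot n).edge (2 * n.natAbs + 2)) = w ^ n * p * (w ^ n)⁻¹ := by
  rw [← edge_len] at hq
  rcases le_or_gt 0 n with hn | hn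
  · have := (coloring_twist_of_nonneg hn hx hp hq n.natAbs le_rfl).1
    rw [add_comm, this, ← zpow_natCast, Int.natAbs_of_nonneg hn]
  · have := (coloring_twist_of_neg hn hx hp hq n.natAbs le_rfl).1
    rw [add_comm, this, ← zpow_natCast, Int.ofNat_natAbs_of_nonpos hn.le]
    group

theorem coloring_even_eq {n : ℤ} {x : Fin (twistKnot n).len → H}
    (hx : (twistKnot n).IsColoring x) {a : H} (h2 : x ((twistKnot n).edge 2) = a)
    (h0 : x ((twistKnot n).edge 0) = a) {k : ℕ} (hk : k ≤ n.natAbs) :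
    x ((twistKnot n).edge (2 + 2 * k)) = a ∧
    x ((twistKnot n).edge (4 * n.natAbs + 4 - 2 * k)) = a := by
  rw [← edge_len] at h0
  rcases le_or_gt 0 n with hn | hn
  · simpa using coloring_twist_of_nonneg (w := 1) hn hx h2 (by simpa using h0) k hk
  · simpa using coloring_twist_of_neg (w := 1) hn hx h2 (by simpa using h0) k hk

/-- With `w = 1` the twist conjugates nothing. This serves to show that a representation in which
`a` and `c` commute is abelian. -/
theorem coloring_const {n : ℤ} {x : Fin (twistKnot n).len → H}
    (hx : (twistKnot n).IsColoring x) {a : H} (h2 : x ((twistKnot n).edge 2) = a)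
    (h0 : x ((twistKnot n).edge 0) = a) (i : Fin (twistKnot n).len) : x i = a := by
  have heven : ∀ j, j ≤ 4 * n.natAbs + 4 → Even j → x ((twistKnot n).edge j) = a := by
    intro j hj he
    rw [Nat.even_iff] at he
    rcases Nat.eq_zero_or_pos j with rfl | hj0
    · exact h0
    rcases le_or_gt j (2 * n.natAbs + 2) with h | h
    · have := (coloring_even_eq hx h2 h0 (k := (j - 2) / 2) (by omega)).1
      rwa [show 2 + 2 * ((j - 2) / 2) = j by omega] at this
    · have := (coloring_even_eq hx h2 h0 (k := (4 * n.natAbs + 4 - j) / 2) (by omega)).2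
      rwa [show 4 * n.natAbs + 4 - 2 * ((4 * n.natAbs + 4 - j) / 2) = j by omega] at this
  have hi := i.2
  simp only [len_twistKnot] at hi
  rw [← edge_val _ i]
  generalize (i : ℕ) = j at hi
  rcases Nat.even_or_odd j with he | ho
  · exact heven j hi.le he
  · by_cases hc : IsClasp (2 * n.natAbs) j
    · obtain ⟨k, rfl⟩ : ∃ k, j = k + 1 := ⟨j - 1, by rw [Nat.odd_iff] at ho; omega⟩
      have hk : Even k := by rw [Nat.odd_iff] at ho; rw [Nat.even_iff]; omega
      have e := edge_succ hx k
      rw [pick_clasp_even x (by rw [Nat.odd_iff] at ho; simp only [IsClasp] at hc ⊢; omega) hk,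
        heven k (by omega) hk] at e
      simpa using e
    · rcases le_or_gt 0 n with hn | hn
      · obtain ⟨k, rfl⟩ : ∃ k, j = k + 1 := ⟨j - 1, by rw [Nat.odd_iff] at ho; omega⟩
        have hk : Even k := by rw [Nat.odd_iff] at ho; rw [Nat.even_iff]; omega
        have e := edge_succ hx k
        rw [pick_pos_even hn x (by omega) hk, heven k (by omega) hk] at e
        simpa using e
      · have e := edge_succ hx j
        rw [pick_neg_odd hn x hc hi ho, heven (j + 1) (by omega) ho.add_one] at e
        simpa using e.symm

theorem prod_pick {n : ℤ} {x : Fin (twistKnot n).len → H}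
    (hx : (twistKnot n).IsColoring x) {p w c : H} (hp : x ((twistKnot n).edge 2) = p)
    (hq : x ((twistKnot n).edge 0) = p * w)
    (hc : x ((twistKnot n).edge (2 * n.natAbs + 2)) = c) :
    (List.ofFn ((twistKnot n).pick x)).prod =
      c * p ^ (-n) * w ^ (-n) * (p * w) * w ^ n * (p * w) ^ (-n) := by
  have h : (List.ofFn ((twistKnot n).pick x)).prod = pickProd n x (4 * n.natAbs + 4) := by
    rw [pickProd, ← prod_ofFn_eq_prod_range, ← len_twistKnot]
    simp only [edge_val]
  rw [← edge_len] at hq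
  rw [h]
  rcases le_or_gt 0 n with hn | hn
  · exact pickProd_len_nonneg hn hx hp hq hc
  · exact pickProd_len_neg hn hx hp hq hc

/-- Colouring every edge by the generator of `ℤ`, each lower passage picks up the sign of its
crossing; the writhe is thus the image of the longitude word in `prod_pick` under abelianization. -/
theorem writhe_twistKnot (n : ℤ) : (twistKnot n).writhe = 2 - 2 * n := by
  let x : Fin (twistKnot n).len → Multiplicative ℤ := fun _ => Multiplicative.ofAdd 1
  have hx : (twistKnot n).IsColoring x := fun i => by simp [x]
  have h := prod_pick hx (p := Multiplicative.ofAdd 1) (w := 1) (c := Multiplicative.ofAdd 1)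
    rfl rfl rfl
  rw [List.prod_ofFn] at h
  have h2 := congrArg Multiplicative.toAdd h
  rw [toAdd_prod] at h2
  simp only [one_zpow, mul_one, toAdd_mul, toAdd_zpow, toAdd_ofAdd] at h2
  rw [writhe, show 2 - 2 * n = 1 + -n * 1 + 1 + -n * 1 by ring]
  simp only [smul_eq_mul] at h2
  rw [← h2]
  refine Finset.sum_congr rfl fun i _ => ?_
  simp only [pick, x]
  split_ifs <;> simp

theorem hom_relation (n : ℤ) (ρ : (twistKnot n).Grp →* H) :
    ∃ a c p w : H, ρ (twistKnot n).meridian = a ∧ p = c⁻¹ * a * c ∧ a = p * w ∧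
      c = w ^ n * p * (w ^ n)⁻¹ ∧
      ρ (twistKnot n).longitude =
        a ^ (-n) * (c * ((w ^ n)⁻¹ * a * w ^ n)) * a ^ (n - 2) ∧
      (a * c = c * a → ∀ g g', ρ g * ρ g' = ρ g' * ρ g) := by
  have hx := isColoring_of_hom _ ρ
  set x := fun i => ρ (PresentedGroup.of i) with hxdef
  have h2 := coloring_edge_two hx
  have h0 : x ((twistKnot n).edge 0) = ρ (twistKnot n).meridian := by
    rw [edge_zero]; rfl
  rw [h0] at h2
  set a := ρ (twistKnot n).meridian with ha
  set c := x ((twistKnot n).edge (2 * n.natAbs + 2)) with hc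
  have haw : a = (c⁻¹ * a * c) * ((c⁻¹ * a * c)⁻¹ * a) := by group
  refine ⟨a, c, c⁻¹ * a * c, (c⁻¹ * a * c)⁻¹ * a, rfl, rfl, haw, ?_, ?_, ?_⟩
  · exact coloring_relation hx h2 (h0.trans haw)
  · have h := prod_pick hx h2 (h0.trans haw) rfl
    rw [hom_longitude, h, writhe_twistKnot, ← haw, ← hc, ← ha]
    have : (c⁻¹ * a * c) ^ (-n) = c⁻¹ * a ^ (-n) * c := by
      simpa using conj_zpow (i := -n) (a := c⁻¹) (b := a)
    rw [this]
    generalize (c⁻¹ * a * c)⁻¹ * a = w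
    rw [show n - 2 = -n + -(2 - 2 * n) by ring, zpow_add]
    group
  · intro hcomm
    refine hom_commute_of_forall_eq _ ρ a fun i => coloring_const hx ?_ h0 i
    rw [h2, mul_assoc, hcomm]
    group

/-! ### Homomorphisms constructed from solutions of the relation. -/

/-- The colours of the edges, given those of the first edge of the left-going strand of the
horizontal twist and the product `w` of the (antiparallel) strands. -/
def twistColor (n : ℤ) (p w c : H) (i : ℕ) : H :=
  if i < 2 then p * w
  else if i ≤ 2 * n.natAbs + 2 then
    if 0 ≤ n then w ^ ((i - 2) / 2) * p * (w ^ ((i - 2) / 2))⁻¹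
    else (w ^ ((i - 1) / 2))⁻¹ * p * w ^ ((i - 1) / 2)
  else if i = 2 * n.natAbs + 3 then c
  else if 0 ≤ n then
    w ^ ((4 * n.natAbs + 5 - i) / 2) * (p * w) * (w ^ ((4 * n.natAbs + 5 - i) / 2))⁻¹
  else (w ^ ((4 * n.natAbs + 4 - i) / 2))⁻¹ * (p * w) * w ^ ((4 * n.natAbs + 4 - i) / 2)

section twistColor

variable (n : ℤ) (p w c : H)

theorem twistColor_zero : twistColor n p w c 0 = p * w := by simp [twistColor]

theorem twistColor_one : twistColor n p w c 1 = p * w := by simp [twistColor]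

theorem twistColor_clasp : twistColor n p w c (2 * n.natAbs + 3) = c := by simp [twistColor]

theorem twistColor_len : twistColor n p w c (4 * n.natAbs + 4) = p * w := by
  have h1 : ¬ (4 * n.natAbs + 4 ≤ 2 * n.natAbs + 2) := by omega
  have h2 : ¬ (4 * n.natAbs + 4 = 2 * n.natAbs + 3) := by omega
  simp [twistColor, h1, h2]

theorem twistColor_first {i : ℕ} (hn : 0 ≤ n) (k : ℕ) (hi : 2 ≤ i) (hi' : i ≤ 2 * n.natAbs + 2)
    (hk : (i - 2) / 2 = k) : twistColor n p w c i = w ^ k * p * (w ^ k)⁻¹ := by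
  have h1 : ¬ (i < 2) := by omega
  simp [twistColor, hi', h1, hn, hk]

theorem twistColor_first_neg {i : ℕ} (hn : n < 0) (k : ℕ) (hi : 2 ≤ i)
    (hi' : i ≤ 2 * n.natAbs + 2)
    (hk : (i - 1) / 2 = k) : twistColor n p w c i = (w ^ k)⁻¹ * p * w ^ k := by
  have h1 : ¬ (i < 2) := by omega
  simp [twistColor, hi', h1, hn.not_ge, hk]

theorem twistColor_second {i : ℕ} (hn : 0 ≤ n) (k : ℕ) (hi : 2 * n.natAbs + 4 ≤ i)
    (hk : (4 * n.natAbs + 5 - i) / 2 = k) :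
    twistColor n p w c i = w ^ k * (p * w) * (w ^ k)⁻¹ := by
  have h1 : ¬ (i < 2) := by omega
  have h2 : ¬ (i ≤ 2 * n.natAbs + 2) := by omega
  have h3 : ¬ (i = 2 * n.natAbs + 3) := by omega
  simp [twistColor, h1, h2, h3, hn, hk]

theorem twistColor_second_neg {i : ℕ} (hn : n < 0) (k : ℕ) (hi : 2 * n.natAbs + 4 ≤ i)
    (hk : (4 * n.natAbs + 4 - i) / 2 = k) :
    twistColor n p w c i = (w ^ k)⁻¹ * (p * w) * w ^ k := by
  have h1 : ¬ (i < 2) := by omega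
  have h2 : ¬ (i ≤ 2 * n.natAbs + 2) := by omega
  have h3 : ¬ (i = 2 * n.natAbs + 3) := by omega
  simp [twistColor, h1, h2, h3, hn.not_ge, hk]

theorem twistColor_last (hc : c = w ^ n * p * (w ^ n)⁻¹) :
    twistColor n p w c (2 * n.natAbs + 2) = c := by
  rcases le_or_gt 0 n with hn | hn
  · rw [twistColor_first n p w c hn n.natAbs (by omega) (by omega) (by omega), hc,
      ← zpow_natCast, Int.natAbs_of_nonneg hn]
  · rw [twistColor_first_neg n p w c hn n.natAbs (by omega) (by omega) (by omega), hc,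
      ← zpow_natCast, Int.ofNat_natAbs_of_nonpos hn.le]
    group

theorem twistColor_second_start (hc : c = w ^ n * p * (w ^ n)⁻¹) :
    twistColor n p w c (2 * n.natAbs + 4) = c * w := by
  rcases le_or_gt 0 n with hn | hn
  · rw [twistColor_second n p w c hn n.natAbs (by omega) (by omega), hc,
      ← zpow_natCast, Int.natAbs_of_nonneg hn]
    group
  · rw [twistColor_second_neg n p w c hn n.natAbs (by omega) (by omega), hc,
      ← zpow_natCast, Int.ofNat_natAbs_of_nonpos hn.le]
    group

end twistColor

/-- Inside the twist the Wirtinger relations are identities in `p` and `w`. The hypotheses are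
needed only at the clasp: `hc` makes the end of the twist match `c`, and `hp` is the relation at the
lower passage next to the base point. -/
theorem isColoring_twistColor {n : ℤ} {a p w c : H} (hp : p = c⁻¹ * a * c) (ha : a = p * w)
    (hc : c = w ^ n * p * (w ^ n)⁻¹) :
    (twistKnot n).IsColoring fun i => twistColor n p w c i := by
  set x : Fin (twistKnot n).len → H := fun i => twistColor n p w c i with hx
  have hX : ∀ j ≤ 4 * n.natAbs + 4, x ((twistKnot n).edge j) = twistColor n p w c j := by
    intro j hj
    rcases hj.eq_or_lt with rfl | hj
    · rw [edge_len, twistColor_len]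
      simp [hx, val_edge, twistColor_zero]
    · simp [hx, val_edge hj]
  intro i
  have hi := i.2
  simp only [len_twistKnot] at hi
  rw [← edge_val _ i, ← edge_add_one]
  generalize (i : ℕ) = j at hi
  rw [hX _ hi, hX _ hi.le]
  by_cases hcl : IsClasp (2 * n.natAbs) j
  · rcases hcl with h | rfl | rfl
    · rcases (show j = 0 ∨ j = 1 by omega) with rfl | rfl
      · rw [pick_clasp_even x (Or.inl (by omega)) (by simp), twistColor_one, twistColor_zero]
        simp
      · rw [pick_clasp_odd (j := 2 * n.natAbs + 2) x (Or.inl (by omega)) (by simp) (by omega),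
          hX _ (by omega), twistColor_last n p w c hc, twistColor_one, ← ha, ← hp]
        rcases le_or_gt 0 n with hn | hn
        · rw [twistColor_first n p w c hn 0 (by omega) (by omega) (by omega)]; simp
        · rw [twistColor_first_neg n p w c hn 0 (by omega) (by omega) (by omega)]; simp
    · rw [pick_clasp_even x (Or.inr (Or.inl rfl)) (by simp [parity_simps]), twistColor_clasp,
        twistColor_last n p w c hc]
      simp
    · rw [pick_clasp_odd (j := 0) x (Or.inr (Or.inr rfl)) (by simp [parity_simps]) (by omega),
        hX _ (by omega), twistColor_clasp, twistColor_zero, ← ha,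
        twistColor_second_start n p w c hc]
      have : w = p⁻¹ * a := by rw [ha]; group
      rw [this, hp]
      group
  · have hcl' := hcl
    simp only [IsClasp] at hcl'
    rcases le_or_gt 0 n with hn | hn
    · rcases Nat.even_or_odd j with he | ho
      · rw [pick_pos_even hn x hi he]
        rw [Nat.even_iff] at he
        rcases le_or_gt j (2 * n.natAbs + 2) with h | h
        · rw [twistColor_first n p w c hn ((j - 2) / 2) (by omega) (by omega) (by omega),
            twistColor_first n p w c hn ((j - 2) / 2) (by omega) (by omega) (by omega)]
          simp
        · rw [twistColor_second n p w c hn ((4 * n.natAbs + 4 - j) / 2) (by omega) (by omega),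
            twistColor_second n p w c hn ((4 * n.natAbs + 4 - j) / 2) (by omega) (by omega)]
          simp
      · rw [pick_pos_odd hn x (j := 4 * n.natAbs + 5 - j) hcl hi ho (by omega),
          hX _ (by omega)]
        rw [Nat.odd_iff] at ho
        rcases le_or_gt j (2 * n.natAbs + 2) with h | h
        · obtain ⟨k, rfl⟩ : ∃ k, j = 3 + 2 * k := ⟨(j - 3) / 2, by omega⟩
          rw [twistColor_first (i := 3 + 2 * k) n p w c hn k (by omega) (by omega) (by omega),
            twistColor_first (i := 3 + 2 * k + 1) n p w c hn (k + 1) (by omega) (by omega)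
              (by omega),
            twistColor_second n p w c hn (k + 1) (by omega) (by omega)]
          group
        · obtain ⟨k, hk⟩ : ∃ k, 4 * n.natAbs + 5 - j = 2 + 2 * k :=
            ⟨(4 * n.natAbs + 5 - j - 2) / 2, by omega⟩
          rw [twistColor_second (i := j + 1) n p w c hn k (by omega) (by omega),
            twistColor_second (i := j) n p w c hn (k + 1) (by omega) (by omega),
            twistColor_first n p w c hn k (by omega) (by omega) (by omega)]
          group
    · rcases Nat.even_or_odd j with he | ho
      · rw [pick_neg_even hn x (j := 4 * n.natAbs + 5 - j) hcl hi he (by omega),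
          hX _ (by omega)]
        rw [Nat.even_iff] at he
        rcases le_or_gt j (2 * n.natAbs + 2) with h | h
        · obtain ⟨k, rfl⟩ : ∃ k, j = 2 + 2 * k := ⟨(j - 2) / 2, by omega⟩
          rw [twistColor_first_neg (i := 2 + 2 * k) n p w c hn k (by omega) (by omega) (by omega),
            twistColor_first_neg (i := 2 + 2 * k + 1) n p w c hn (k + 1) (by omega) (by omega)
              (by omega),
            twistColor_second_neg n p w c hn k (by omega) (by omega)]
          group
        · obtain ⟨k, hk⟩ : ∃ k, 4 * n.natAbs + 5 - j = 3 + 2 * k :=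
            ⟨(4 * n.natAbs + 5 - j - 3) / 2, by omega⟩
          rw [twistColor_second_neg (i := j + 1) n p w c hn k (by omega) (by omega),
            twistColor_second_neg (i := j) n p w c hn (k + 1) (by omega) (by omega),
            twistColor_first_neg n p w c hn (k + 1) (by omega) (by omega) (by omega)]
          group
      · rw [pick_neg_odd hn x hcl hi ho]
        rw [Nat.odd_iff] at ho
        rcases le_or_gt j (2 * n.natAbs + 2) with h | h
        · rw [twistColor_first_neg n p w c hn ((j - 1) / 2) (by omega) (by omega) (by omega),
            twistColor_first_neg n p w c hn ((j - 1) / 2) (by omega) (by omega) (by omega)]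
          simp
        · rw [twistColor_second_neg n p w c hn ((4 * n.natAbs + 4 - j) / 2) (by omega) (by omega),
            twistColor_second_neg n p w c hn ((4 * n.natAbs + 4 - j) / 2) (by omega) (by omega)]
          simp

theorem exists_hom {n : ℤ} {a p w c : H} (hp : p = c⁻¹ * a * c) (ha : a = p * w)
    (hc : c = w ^ n * p * (w ^ n)⁻¹) :
    ∃ ρ : (twistKnot n).Grp →* H, ρ (twistKnot n).meridian = a ∧ (∃ g, ρ g = c) ∧
      ρ (twistKnot n).longitude =
        a ^ (-n) * (c * ((w ^ n)⁻¹ * a * w ^ n)) * a ^ (n - 2) := by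
  have hx := isColoring_twistColor hp ha hc
  have hm : hx.hom (twistKnot n).meridian = a := by
    rw [meridian, hx.hom_of, ha]
    simp [twistColor_zero]
  have hcc : hx.hom (PresentedGroup.of ((twistKnot n).edge (2 * n.natAbs + 2))) = c := by
    rw [hx.hom_of, val_edge (by omega), twistColor_last n p w c hc]
  refine ⟨hx.hom, hm, ⟨_, hcc⟩, ?_⟩
  have h := prod_pick hx (p := p) (w := w) (c := c) ?_ ?_ ?_
  · rw [hom_longitude, hm, writhe_twistKnot]
    simp only [hx.hom_of]
    rw [h, ← ha]
    have : p ^ (-n) = c⁻¹ * a ^ (-n) * c := by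
      rw [hp]
      simpa using conj_zpow (i := -n) (a := c⁻¹) (b := a)
    rw [this, show n - 2 = -n + -(2 - 2 * n) by ring, zpow_add]
    group
  · rw [coloring_edge_two hx]
    simp only [val_edge (n := n) (i := 0) (by omega),
      val_edge (n := n) (i := 2 * n.natAbs + 2) (by omega), twistColor_zero,
      twistColor_last n p w c hc, ← ha, ← hp]
  · simp only [val_edge (n := n) (i := 0) (by omega), twistColor_zero]
  · simp only [val_edge (n := n) (i := 2 * n.natAbs + 2) (by omega), twistColor_last n p w c hc]

/-! ### Representations in `SL₂` and the Riley polynomial. -/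

open Polynomial.Chebyshev in
/-- Integral powers in `SL₂` by means of Chebyshev polynomials in the trace. -/
theorem coe_zpow_eq_chebyshev {R : Type*} [CommRing R] (W : Matrix.SpecialLinearGroup (Fin 2) R)
    (τ : R) (hτ : W 0 0 + W 1 1 = τ) (n : ℤ) :
    ((W ^ n : Matrix.SpecialLinearGroup (Fin 2) R) : Matrix (Fin 2) (Fin 2) R) =
      (S R (n - 1)).eval τ • (W : Matrix (Fin 2) (Fin 2) R) - (S R (n - 2)).eval τ • 1 := by
  have hd := W.det_coe
  rw [Matrix.det_fin_two] at hd
  have hsq : (W : Matrix (Fin 2) (Fin 2) R) * W = τ • (W : Matrix (Fin 2) (Fin 2) R) - 1 := by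
    rw [← hτ, Matrix.eta_fin_two (W : Matrix (Fin 2) (Fin 2) R)]
    ext i j
    fin_cases i <;> fin_cases j <;> simp [Matrix.mul_apply, Fin.sum_univ_two] <;>
      first | ring1 | linear_combination -hd
  have hinv : ((W⁻¹ : Matrix.SpecialLinearGroup (Fin 2) R) : Matrix (Fin 2) (Fin 2) R) =
      τ • 1 - (W : Matrix (Fin 2) (Fin 2) R) := by
    rw [Matrix.SpecialLinearGroup.coe_inv, ← hτ, Matrix.adjugate_fin_two]
    ext i j
    fin_cases i <;> fin_cases j <;> simp
  have hWi : (W : Matrix (Fin 2) (Fin 2) R) * (τ • 1 - (W : Matrix (Fin 2) (Fin 2) R)) = 1 := by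
    rw [← hinv, ← Matrix.SpecialLinearGroup.coe_mul, mul_inv_cancel,
      Matrix.SpecialLinearGroup.coe_one]
  induction n using Int.induction_on with
  | zero =>
    simp
  | succ k ih =>
    rw [zpow_add_one, Matrix.SpecialLinearGroup.coe_mul, ih, sub_mul, Matrix.smul_mul, hsq]
    have := congrArg (Polynomial.eval τ) (S_add_two R ((k : ℤ) - 2))
    simp only [Polynomial.eval_sub, Polynomial.eval_mul, Polynomial.eval_X] at this
    rw [show (k : ℤ) - 2 + 2 = k + 1 - 1 by ring, show (k : ℤ) - 2 + 1 = k - 1 by ring] at this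
    rw [this, show (k : ℤ) + 1 - 2 = k - 1 by ring]
    simp only [Matrix.smul_mul, one_mul]
    module
  | pred k ih =>
    rw [zpow_sub_one, Matrix.SpecialLinearGroup.coe_mul, ih, hinv, sub_mul, Matrix.smul_mul, hWi]
    have := congrArg (Polynomial.eval τ) (S_add_two R (-(k : ℤ) - 3))
    simp only [Polynomial.eval_sub, Polynomial.eval_mul, Polynomial.eval_X] at this
    rw [show -(k : ℤ) - 3 + 2 = -k - 1 by ring, show -(k : ℤ) - 3 + 1 = -k - 2 by ring] at this
    rw [this, show -(k : ℤ) - 1 - 1 = -k - 2 by ring, show -(k : ℤ) - 1 - 2 = -k - 3 by ring]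
    simp only [Matrix.smul_mul, one_mul]
    module

open Polynomial.Chebyshev in
/-- The Riley polynomial of the twist knot, where `u + 2` is the trace of `a * c⁻¹` and `z + 2` is the
square of the trace of a meridian. -/
noncomputable def riley (n : ℤ) (u z : ℂ) : ℂ :=
  (S ℂ n).eval (2 + u * (u + 2 - z)) - (z - 1 - u) * (S ℂ (n - 1)).eval (2 + u * (u + 2 - z))

section Upper

variable {g h : Matrix.SpecialLinearGroup (Fin 2) ℂ}

theorem upper_mul (hg : g 1 0 = 0) (hh : h 1 0 = 0) :
    (g * h) 1 0 = 0 ∧ (g * h) 0 0 = g 0 0 * h 0 0 := by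
  simp [Matrix.SpecialLinearGroup.coe_mul, Matrix.mul_apply, Fin.sum_univ_two, hg, hh]

theorem upper_diag (hg : g 1 0 = 0) : g 0 0 * g 1 1 = 1 := by
  have := g.det_coe
  rw [Matrix.det_fin_two] at this
  simpa [hg] using this

theorem upper_inv (hg : g 1 0 = 0) : (g⁻¹) 1 0 = 0 ∧ (g⁻¹) 0 0 = (g 0 0)⁻¹ := by
  constructor
  · simp [Matrix.SpecialLinearGroup.coe_inv, Matrix.adjugate_fin_two, hg]
  · simpa [Matrix.SpecialLinearGroup.coe_inv, Matrix.adjugate_fin_two] using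
      eq_inv_of_mul_eq_one_right (upper_diag hg)

theorem upper_zpow (hg : g 1 0 = 0) (n : ℤ) :
    (g ^ n) 1 0 = 0 ∧ (g ^ n) 0 0 = (g 0 0) ^ n := by
  have h0 : g 0 0 ≠ 0 := left_ne_zero_of_mul_eq_one (upper_diag hg)
  induction n using Int.induction_on with
  | zero => simp
  | succ k ih =>
    rw [zpow_add_one, zpow_add_one₀ h0, (upper_mul ih.1 hg).2, ih.2]
    exact ⟨(upper_mul ih.1 hg).1, rfl⟩
  | pred k ih =>
    have hi := upper_inv hg
    rw [zpow_sub_one, zpow_sub_one₀ h0, (upper_mul ih.1 hi.1).2, ih.2, hi.2]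
    exact ⟨(upper_mul ih.1 hi.1).1, rfl⟩

end Upper

/-- Matrices in `SL₂` that satisfy the defining relation of the group of the twist knot, with the
lower left entry of the second generator not zero. -/
theorem riley_eq_zero_of_relation {n : ℤ} {a c p w l : Matrix.SpecialLinearGroup (Fin 2) ℂ}
    (hp : p = c⁻¹ * a * c) (ha : a = p * w) (hc : c = w ^ n * p * (w ^ n)⁻¹)
    (hl : l = a ^ (-n) * (c * ((w ^ n)⁻¹ * a * w ^ n)) * a ^ (n - 2))
    {M m x y L : ℂ} (hM : M * m = 1) (hy : y ≠ 0)
    (hae : (a : Matrix (Fin 2) (Fin 2) ℂ) = !![M, x; 0, m])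
    (hce : (c : Matrix (Fin 2) (Fin 2) ℂ) = !![M, 0; -y, m])
    (hl10 : l 1 0 = 0) (hl00 : l 0 0 = L) :
    riley n (x * y) (M ^ 2 + m ^ 2) = 0 ∧
      L * (1 - M ^ 2 - x * y * M ^ 2) = 1 - M ^ 2 + x * y := by
  have hM0 : M ≠ 0 := left_ne_zero_of_mul_eq_one hM
  have hcw : c * w = a⁻¹ * c * a := by
    have : w = p⁻¹ * a := by rw [ha]; group
    rw [this, hp]; group
  have hw : w = c⁻¹ * (a⁻¹ * c * a) := by rw [← hcw]; group
  have hr : (a⁻¹ * c * a) * w ^ n = w ^ n * a := by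
    rw [← hcw]
    nth_rewrite 1 [hc]
    rw [ha]; group
  set d := (w ^ n)⁻¹ * a * w ^ n with hd
  have hd' : w ^ n * d = a * w ^ n := by rw [hd]; group
  have hAe : ((a⁻¹ * c * a : Matrix.SpecialLinearGroup (Fin 2) ℂ) : Matrix (Fin 2) (Fin 2) ℂ) =
      !![M + x * y * M, x * (1 - m ^ 2 + x * y); -y * M ^ 2, m - x * y * M] := by
    rw [Matrix.SpecialLinearGroup.coe_mul, Matrix.SpecialLinearGroup.coe_mul,
      Matrix.SpecialLinearGroup.coe_inv, hae, hce, Matrix.adjugate_fin_two_of]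
    ext i j
    fin_cases i <;> fin_cases j <;> simp
    · linear_combination M * hM
    · linear_combination x * hM
    · ring
    · linear_combination m * hM
  have hWe : (w : Matrix (Fin 2) (Fin 2) ℂ) =
      !![1 + x * y, x * m * (1 + x * y - m ^ 2); y * M * (1 - M ^ 2 + x * y),
        (x * y) ^ 2 + x * y + 1 - x * y * (M ^ 2 + m ^ 2)] := by
    rw [hw, Matrix.SpecialLinearGroup.coe_mul, hAe, Matrix.SpecialLinearGroup.coe_inv, hce,
      Matrix.adjugate_fin_two_of]
    ext i j
    fin_cases i <;> fin_cases j <;> simp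
    · linear_combination (1 + x * y) * hM
    · ring
    · ring
    · linear_combination hM
  have htr : w 0 0 + w 1 1 = 2 + x * y * (x * y + 2 - (M ^ 2 + m ^ 2)) := by
    simp only [hWe, Matrix.of_apply, Matrix.cons_val', Matrix.cons_val_zero, Matrix.cons_val_one,
      Matrix.cons_val_fin_one]
    ring
  have hpow := coe_zpow_eq_chebyshev w _ htr n
  set u := x * y with hu
  set z := M ^ 2 + m ^ 2 with hz
  set s := (Polynomial.Chebyshev.S ℂ (n - 1)).eval (2 + u * (u + 2 - z)) with hs
  set s' := (Polynomial.Chebyshev.S ℂ (n - 2)).eval (2 + u * (u + 2 - z)) with hs'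
  have hrec : (Polynomial.Chebyshev.S ℂ n).eval (2 + u * (u + 2 - z)) =
      (2 + u * (u + 2 - z)) * s - s' := by
    rw [Polynomial.Chebyshev.S_eq]; simp [hs, hs']
  have hpe : ((w ^ n : Matrix.SpecialLinearGroup (Fin 2) ℂ) : Matrix (Fin 2) (Fin 2) ℂ) =
      !![s * (1 + u) - s', s * (x * m * (1 + u - m ^ 2)); s * (y * M * (1 - M ^ 2 + u)),
        s * (u ^ 2 + u + 1 - u * z) - s'] := by
    rw [hpow, hWe]
    ext i j
    fin_cases i <;> fin_cases j <;> simp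
  -- The lower left entry of the group relation is, up to sign and `M * m = 1`, the Riley polynomial
  -- times the nonzero factor `y * M ^ 2`.
  have e1 := congrFun (congrFun (congrArg Subtype.val hr) 1) 0
  simp only [Matrix.SpecialLinearGroup.coe_mul] at e1
  rw [← Matrix.SpecialLinearGroup.coe_mul, ← Matrix.SpecialLinearGroup.coe_mul, hAe, hpe, hae] at e1
  simp at e1
  have hR : riley n u z = 0 := by
    have : y * M ^ 2 * riley n u z = 0 := by
      rw [riley, hrec, ← hs]
      rw [hz]
      linear_combination -e1 + (s * y * (1 - M ^ 2 + u) - s * y * (u + 1) * (1 + M * m)) * hM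
    have h2 : y * M ^ 2 ≠ 0 := mul_ne_zero hy (pow_ne_zero _ hM0)
    exact (mul_eq_zero.1 this).resolve_left h2
  refine ⟨hR, ?_⟩
  rw [riley, hrec, ← hs] at hR
  -- Otherwise the Riley equation gives `s' = 0`, and `w ^ n = s • w - s' • 1` would be the zero
  -- matrix.
  have hs0 : s ≠ 0 := by
    intro h0
    have h1 : s' = 0 := by rw [h0] at hR; linear_combination -hR
    have := (w ^ n).det_coe
    rw [hpe, h0, h1] at this
    simp at this
  have ha10 : a 1 0 = 0 := by rw [hae]; simp
  have ha00 : a 0 0 = M := by rw [hae]; simp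
  -- So `c * d` is upper triangular with upper left entry `L * M ^ 2`, which determines the first
  -- column of `d`.
  have hcd : c * d = a ^ n * l * a ^ (2 - n) := by
    rw [hl]; group
  have hup := upper_mul (upper_mul (upper_zpow ha10 n).1 hl10).1 (upper_zpow ha10 (2 - n)).1
  rw [← hcd, (upper_mul (upper_zpow ha10 n).1 hl10).2, (upper_zpow ha10 n).2,
    (upper_zpow ha10 (2 - n)).2, ha00, hl00,
    show M ^ n * L * M ^ (2 - n) = L * (M ^ n * M ^ (2 - n)) by ring, ← zpow_add₀ hM0,
    show n + (2 - n) = 2 by ring] at hup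
  obtain ⟨hc10, hc00⟩ := hup
  rw [Matrix.SpecialLinearGroup.coe_mul, hce] at hc10 hc00
  simp [Matrix.mul_apply, Fin.sum_univ_two] at hc10 hc00
  have hd00 : d 0 0 = L * M := by
    apply mul_left_cancel₀ hM0
    rw [hc00]; ring
  have hd10 : d 1 0 = y * L * M ^ 2 := by
    rw [hd00] at hc10
    linear_combination M * hc10 - d 1 0 * hM
  -- Modulo the Riley equation, the lower left entry of `w ^ n * d = a * w ^ n` is `s * y` times the
  -- relation between `L` and `u`.
  have e2 := congrFun (congrFun (congrArg Subtype.val hd') 1) 0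
  simp only [Matrix.SpecialLinearGroup.coe_mul] at e2
  rw [hpe, hae] at e2
  simp [Matrix.mul_apply, Fin.sum_univ_two, hd00, hd10] at e2
  have e3 : s * y * (L * (1 - M ^ 2 - u * M ^ 2) - (1 - M ^ 2 + u)) = 0 := by
    rw [hz] at e2 hR
    linear_combination e2 - y * L * M ^ 2 * hR +
      (s * y * (1 - M ^ 2 + u) - s * y * L * (M * m + 1)) * hM
  have := (mul_eq_zero.1 e3).resolve_left (mul_ne_zero hs0 hy)
  linear_combination this

/-- Triangular matrices in `SL₂` that satisfy the defining relation of the group of the twist knot and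
do not commute. -/
theorem alexander_eq_zero_of_relation {n : ℤ} {a c p w l : Matrix.SpecialLinearGroup (Fin 2) ℂ}
    (hp : p = c⁻¹ * a * c) (ha : a = p * w) (hc : c = w ^ n * p * (w ^ n)⁻¹)
    (hl : l = a ^ (-n) * (c * ((w ^ n)⁻¹ * a * w ^ n)) * a ^ (n - 2))
    (hac : a * c ≠ c * a) {M m : ℂ} (hM : M * m = 1)
    (ha10 : a 1 0 = 0) (ha00 : a 0 0 = M) (hc10 : c 1 0 = 0) :
    n * (M ^ 2 + m ^ 2 - 2) = 1 ∧ l 0 0 = 1 := by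
  have hM0 : M ≠ 0 := left_ne_zero_of_mul_eq_one hM
  have hm0 : m ≠ 0 := right_ne_zero_of_mul_eq_one hM
  have hcw : c * w = a⁻¹ * c * a := by
    have : w = p⁻¹ * a := by rw [ha]; group
    rw [this, hp]; group
  have hw : w = c⁻¹ * (a⁻¹ * c * a) := by rw [← hcw]; group
  have hr : (a⁻¹ * c * a) * w ^ n = w ^ n * a := by
    rw [← hcw]
    nth_rewrite 1 [hc]
    rw [ha]; group
  have hp' := upper_mul (upper_mul (upper_inv hc10).1 ha10).1 hc10
  have hc0 : c 0 0 ≠ 0 := left_ne_zero_of_mul_eq_one (upper_diag hc10)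
  rw [← hp, (upper_mul (upper_inv hc10).1 ha10).2, (upper_inv hc10).2, ha00,
    inv_mul_eq_div, div_mul_cancel₀ _ hc0] at hp'
  obtain ⟨hp10, hp00⟩ := hp'
  have hw' := upper_mul (upper_inv hp10).1 ha10
  have : w = p⁻¹ * a := by rw [ha]; group
  rw [← this, (upper_inv hp10).2, hp00, ha00, inv_mul_cancel₀ hM0] at hw'
  obtain ⟨hw10, hw00⟩ := hw'
  have hwn := upper_zpow hw10 n
  rw [hw00, one_zpow] at hwn
  obtain ⟨hwn10, hwn00⟩ := hwn
  have hwni := upper_inv hwn10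
  rw [hwn00, inv_one] at hwni
  have hc00 : c 0 0 = M := by
    rw [hc, (upper_mul (upper_mul hwn10 hp10).1 hwni.1).2, (upper_mul hwn10 hp10).2, hwn00,
      hwni.2, hp00]
    ring
  have ha11 : a 1 1 = m := by
    have := upper_diag ha10
    rw [ha00] at this
    exact mul_left_cancel₀ hM0 (this.trans hM.symm)
  have hc11 : c 1 1 = m := by
    have := upper_diag hc10
    rw [hc00] at this
    exact mul_left_cancel₀ hM0 (this.trans hM.symm)
  set x := a 0 1 with hx
  set v := c 0 1 with hv
  have hae : (a : Matrix (Fin 2) (Fin 2) ℂ) = !![M, x; 0, m] := by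
    rw [Matrix.eta_fin_two (a : Matrix (Fin 2) (Fin 2) ℂ), ha00, ha10, ha11]
  have hce : (c : Matrix (Fin 2) (Fin 2) ℂ) = !![M, v; 0, m] := by
    rw [Matrix.eta_fin_two (c : Matrix (Fin 2) (Fin 2) ℂ), hc00, hc10, hc11]
  have hAe : ((a⁻¹ * c * a : Matrix.SpecialLinearGroup (Fin 2) ℂ) : Matrix (Fin 2) (Fin 2) ℂ) =
      !![M, x + (v - x) * m ^ 2; 0, m] := by
    rw [Matrix.SpecialLinearGroup.coe_mul, Matrix.SpecialLinearGroup.coe_mul,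
      Matrix.SpecialLinearGroup.coe_inv, hae, hce, Matrix.adjugate_fin_two_of]
    ext i j
    fin_cases i <;> fin_cases j <;> simp
    · linear_combination M * hM
    · linear_combination x * hM
    · linear_combination m * hM
  have hWe : (w : Matrix (Fin 2) (Fin 2) ℂ) =
      !![1, m ^ 2 * (M - m) * (x - v); 0, 1] := by
    rw [hw, Matrix.SpecialLinearGroup.coe_mul, hAe, Matrix.SpecialLinearGroup.coe_inv, hce,
      Matrix.adjugate_fin_two_of]
    ext i j
    fin_cases i <;> fin_cases j <;> simp
    · linear_combination hM
    · linear_combination (m * v - m * x) * hM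
    · linear_combination hM
  -- `w` is unipotent, so the Chebyshev values at `2` are integers linear in `n`; this produces the
  -- Alexander polynomial in `M ^ 2`.
  have htr : w 0 0 + w 1 1 = 2 := by
    rw [hWe]; simp; norm_num
  have hpow := coe_zpow_eq_chebyshev w _ htr n
  rw [Polynomial.Chebyshev.S_eval_two, Polynomial.Chebyshev.S_eval_two, hWe] at hpow
  have hxv : x - v ≠ 0 := by
    intro h
    apply hac
    have hxv : x = v := sub_eq_zero.1 h
    have : a = c := Subtype.ext (by rw [hae, hce, hxv])
    rw [this]
  constructor
  · have e1 := congrFun (congrFun (congrArg Subtype.val hr) 0) 1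
    simp only [Matrix.SpecialLinearGroup.coe_mul] at e1
    rw [← Matrix.SpecialLinearGroup.coe_mul, ← Matrix.SpecialLinearGroup.coe_mul, hAe, hpow,
      hae] at e1
    simp [Matrix.mul_apply, Fin.sum_univ_two] at e1
    have h2 : m ^ 2 * (x - v) * (n * (M ^ 2 + m ^ 2 - 2) - 1) = 0 := by
      linear_combination e1 + (2 * n * m ^ 2 * (x - v)) * hM
    have := (mul_eq_zero.1 h2).resolve_left (mul_ne_zero (pow_ne_zero _ hm0) hxv)
    linear_combination this
  · have h1 := upper_mul (upper_mul hwni.1 ha10).1 hwn10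
    have h2 := upper_mul hc10 h1.1
    have h3 := upper_mul (upper_zpow ha10 (-n)).1 h2.1
    rw [hl, (upper_mul h3.1 (upper_zpow ha10 (n - 2)).1).2, h3.2, h2.2, h1.2,
      (upper_mul hwni.1 ha10).2, hwn00, hwni.2, (upper_zpow ha10 _).2, (upper_zpow ha10 _).2,
      ha00, hc00]
    rw [show M ^ (-n) * (M * (1 * M * 1)) * M ^ (n - 2) = M ^ (-n) * M ^ (2 : ℤ) * M ^ (n - 2) by
      norm_cast; ring, ← zpow_add₀ hM0, ← zpow_add₀ hM0]
    simp

/-- The coordinates of a non-abelian representation of the group of the twist knot: either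
it is upper triangular, or it belongs to a zero of the Riley polynomial. -/
theorem of_mem_eigenvaluePairs {n : ℤ} {p : Fin 2 → ℂ} (h : p ∈ (twistKnot n).eigenvaluePairs) :
    ∃ m, p 1 * m = 1 ∧ ((n * ((p 1) ^ 2 + m ^ 2 - 2) = 1 ∧ p 0 = 1) ∨
      ∃ u, riley n u ((p 1) ^ 2 + m ^ 2) = 0 ∧
        p 0 * (1 - (p 1) ^ 2 - u * (p 1) ^ 2) = 1 - (p 1) ^ 2 + u) := by
  obtain ⟨ρ, ⟨g, g', hgg⟩, hl10, hm10, hl00, hm00⟩ := h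
  obtain ⟨a, c, q, w, hma, hq, ha, hc, hl, hcomm⟩ := hom_relation n ρ
  rw [hma] at hm10 hm00
  have hac : a * c ≠ c * a := fun h => hgg (hcomm h g g')
  have hM := upper_diag hm10
  rw [hm00] at hM
  refine ⟨a 1 1, hM, ?_⟩
  by_cases hc10 : c 1 0 = 0
  · left
    obtain ⟨h1, h2⟩ := alexander_eq_zero_of_relation hq ha hc hl hac hM hm10 hm00 hc10
    exact ⟨h1, hl00 ▸ h2⟩
  · right
    have htr : c 0 0 + c 1 1 = p 1 + a 1 1 := by
      have h1 : (c : Matrix (Fin 2) (Fin 2) ℂ).trace = (q : Matrix (Fin 2) (Fin 2) ℂ).trace := by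
        conv_lhs => rw [hc]
        rw [Matrix.SpecialLinearGroup.coe_mul, Matrix.trace_mul_comm,
          ← Matrix.SpecialLinearGroup.coe_mul, inv_mul_cancel_left]
      have h2 : (q : Matrix (Fin 2) (Fin 2) ℂ).trace = (a : Matrix (Fin 2) (Fin 2) ℂ).trace := by
        rw [hq, Matrix.SpecialLinearGroup.coe_mul, Matrix.trace_mul_comm,
          ← Matrix.SpecialLinearGroup.coe_mul, ← mul_assoc, mul_inv_cancel, one_mul]
      have h3 := h1.trans h2
      rwa [Matrix.trace_fin_two, Matrix.trace_fin_two, hm00] at h3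
    have hdc := c.det_coe
    rw [Matrix.det_fin_two] at hdc
    -- Conjugation by the unipotent matrix with entry `k` preserves upper triangular matrices and
    -- their diagonals. This `k` gives `c` the upper left entry of `a`; as traces and determinants
    -- agree, the upper right entry of `c` then vanishes.
    set k := (p 1 - c 0 0) / c 1 0 with hk
    have hk' : k * c 1 0 = p 1 - c 0 0 := div_mul_cancel₀ _ hc10
    let s : Matrix.SpecialLinearGroup (Fin 2) ℂ := ⟨!![1, k; 0, 1], by simp⟩
    have hs : (s : Matrix (Fin 2) (Fin 2) ℂ) = !![1, k; 0, 1] := rfl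
    have hsi : ((s⁻¹ : Matrix.SpecialLinearGroup (Fin 2) ℂ) : Matrix (Fin 2) (Fin 2) ℂ) =
        !![1, -k; 0, 1] := by
      rw [Matrix.SpecialLinearGroup.coe_inv, hs, Matrix.adjugate_fin_two_of]; simp
    let φ := (MulAut.conj s).toMonoidHom
    have hφ : ∀ g, ((φ g : Matrix.SpecialLinearGroup (Fin 2) ℂ) : Matrix (Fin 2) (Fin 2) ℂ) =
        !![g 0 0 + k * g 1 0, g 0 1 + k * g 1 1 - k * (g 0 0 + k * g 1 0);
          g 1 0, g 1 1 - k * g 1 0] := by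
      intro g
      have : φ g = s * g * s⁻¹ := rfl
      rw [this, Matrix.SpecialLinearGroup.coe_mul, Matrix.SpecialLinearGroup.coe_mul, hs, hsi,
        Matrix.eta_fin_two (g : Matrix (Fin 2) (Fin 2) ℂ)]
      ext i j
      fin_cases i <;> fin_cases j <;> simp <;> ring
    have := riley_eq_zero_of_relation (n := n) (a := φ a) (c := φ c) (p := φ q) (w := φ w)
      (l := φ (ρ (twistKnot n).longitude)) (M := p 1) (m := a 1 1)
      (x := a 0 1 + k * a 1 1 - k * p 1) (y := - c 1 0) (L := p 0)
      (by rw [hq]; simp only [map_mul, map_inv]) (by rw [← map_mul, ← ha])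
      (by conv_lhs => rw [hc]
          simp only [map_mul, map_inv, map_zpow])
      (by rw [hl]; simp only [map_mul, map_inv, map_zpow])
      hM (neg_ne_zero.2 hc10) (by rw [hφ, hm10, hm00]; simp)
      (by
        rw [hφ]
        have h00 : c 0 0 + k * c 1 0 = p 1 := by rw [hk']; ring
        have h11 : c 1 1 - k * c 1 0 = a 1 1 := by
          rw [hk']; linear_combination htr
        have h01 : c 0 1 + k * c 1 1 - k * p 1 = 0 := by
          apply mul_left_cancel₀ hc10
          have e00 : c 0 0 = p 1 - k * c 1 0 := by linear_combination h00
          have e11 : c 1 1 = a 1 1 + k * c 1 0 := by linear_combination h11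
          rw [e00, e11] at hdc
          rw [e11]
          linear_combination -hdc + hM
        rw [h00, h11, h01, neg_neg])
      (by rw [hφ]; simpa using hl10) (by rw [hφ]; simp [hl10, hl00])
    exact ⟨_, this⟩

/-- Every zero of the Riley polynomial belongs to a non-abelian representation. -/
theorem mem_eigenvaluePairs {n : ℤ} {M m u L : ℂ} (hM : M * m = 1) (hu : u ≠ 0)
    (hR : riley n u (M ^ 2 + m ^ 2) = 0) (hu' : 1 - M ^ 2 - u * M ^ 2 ≠ 0)
    (hL : L * (1 - M ^ 2 - u * M ^ 2) = 1 - M ^ 2 + u) :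
    ![L, M] ∈ (twistKnot n).eigenvaluePairs := by
  -- The normal form of `riley_eq_zero_of_relation` with `x = 1` and `y = u`.
  let a : Matrix.SpecialLinearGroup (Fin 2) ℂ := ⟨!![M, 1; 0, m], by simp [hM]⟩
  let c : Matrix.SpecialLinearGroup (Fin 2) ℂ := ⟨!![M, 0; -u, m], by simp [hM]⟩
  have hae : (a : Matrix (Fin 2) (Fin 2) ℂ) = !![M, 1; 0, m] := rfl
  have hce : (c : Matrix (Fin 2) (Fin 2) ℂ) = !![M, 0; -u, m] := rfl
  obtain ⟨w, hw⟩ : ∃ w, w = c⁻¹ * (a⁻¹ * c * a) := ⟨_, rfl⟩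
  obtain ⟨q, hq⟩ : ∃ q, q = c⁻¹ * a * c := ⟨_, rfl⟩
  have ha : a = q * w := by rw [hw, hq]; group
  have hcw : c * w = a⁻¹ * c * a := by rw [hw]; group
  have hAe : ((a⁻¹ * c * a : Matrix.SpecialLinearGroup (Fin 2) ℂ) : Matrix (Fin 2) (Fin 2) ℂ) =
      !![M + u * M, 1 - m ^ 2 + u; -u * M ^ 2, m - u * M] := by
    rw [Matrix.SpecialLinearGroup.coe_mul, Matrix.SpecialLinearGroup.coe_mul,
      Matrix.SpecialLinearGroup.coe_inv, hae, hce, Matrix.adjugate_fin_two_of]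
    ext i j
    fin_cases i <;> fin_cases j <;> simp
    · linear_combination M * hM
    · linear_combination hM
    · ring
    · linear_combination m * hM
  have hWe : (w : Matrix (Fin 2) (Fin 2) ℂ) =
      !![1 + u, m * (1 + u - m ^ 2); u * M * (1 - M ^ 2 + u),
        u ^ 2 + u + 1 - u * (M ^ 2 + m ^ 2)] := by
    rw [hw, Matrix.SpecialLinearGroup.coe_mul, hAe, Matrix.SpecialLinearGroup.coe_inv, hce,
      Matrix.adjugate_fin_two_of]
    ext i j
    fin_cases i <;> fin_cases j <;> simp
    · linear_combination (1 + u) * hM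
    · left; ring
    · ring
    · linear_combination hM
  have htr : w 0 0 + w 1 1 = 2 + u * (u + 2 - (M ^ 2 + m ^ 2)) := by
    simp only [hWe, Matrix.of_apply, Matrix.cons_val', Matrix.cons_val_zero, Matrix.cons_val_one,
      Matrix.cons_val_fin_one]
    ring
  have hpow := coe_zpow_eq_chebyshev w _ htr n
  have hr : (a⁻¹ * c * a) * w ^ n = w ^ n * a := by
    apply Subtype.ext
    change ((a⁻¹ * c * a * w ^ n : Matrix.SpecialLinearGroup (Fin 2) ℂ) :
      Matrix (Fin 2) (Fin 2) ℂ) = ((w ^ n * a : Matrix.SpecialLinearGroup (Fin 2) ℂ) :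
      Matrix (Fin 2) (Fin 2) ℂ)
    set z := M ^ 2 + m ^ 2 with hz
    set s := (Polynomial.Chebyshev.S ℂ (n - 1)).eval (2 + u * (u + 2 - z)) with hs
    set s' := (Polynomial.Chebyshev.S ℂ (n - 2)).eval (2 + u * (u + 2 - z)) with hs'
    have hrec : (Polynomial.Chebyshev.S ℂ n).eval (2 + u * (u + 2 - z)) =
        (2 + u * (u + 2 - z)) * s - s' := by
      rw [Polynomial.Chebyshev.S_eq]; simp [hs, hs']
    rw [riley, hrec, ← hs] at hR
    -- With `s'` eliminated by the Riley equation, all four entries of the relation become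
    -- identities in `M`, `u`, `s`.
    have hs2 : s' = (u ^ 2 + 3 * u + 3 - u * z - z) * s := by linear_combination -hR
    have hpe : ((w ^ n : Matrix.SpecialLinearGroup (Fin 2) ℂ) : Matrix (Fin 2) (Fin 2) ℂ) =
        !![s * (1 + u) - s', s * (m * (1 + u - m ^ 2)); s * (u * M * (1 - M ^ 2 + u)),
          s * (u ^ 2 + u + 1 - u * z) - s'] := by
      rw [hpow, hWe]
      ext i j
      fin_cases i <;> fin_cases j <;> simp
    rw [Matrix.SpecialLinearGroup.coe_mul (a⁻¹ * c * a), Matrix.SpecialLinearGroup.coe_mul (w ^ n),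
      hAe, hpe, hae, hs2, hz]
    have hM0 : M ≠ 0 := left_ne_zero_of_mul_eq_one hM
    clear_value s
    ext i j
    fin_cases i <;> fin_cases j <;> simp <;> rw [eq_inv_of_mul_eq_one_right hM] <;> field_simp <;> ring
  have hc : c = w ^ n * q * (w ^ n)⁻¹ := by
    have h1 : q = a * w⁻¹ := by rw [eq_mul_inv_iff_mul_eq, ha]
    rw [eq_mul_inv_iff_mul_eq, h1, ← mul_assoc, ← hr, ← hcw]
    group
  obtain ⟨ρ, hρm, ⟨g, hg⟩, hρl⟩ := exists_hom hq ha hc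
  have hcomm : a * ρ (twistKnot n).longitude = ρ (twistKnot n).longitude * a := by
    have h1 : a * (c * ((w ^ n)⁻¹ * a * w ^ n)) = c * ((w ^ n)⁻¹ * a * w ^ n) * a := by
      have e1 : a * c = c * q := by rw [hq]; group
      have e2 : q * (w ^ n)⁻¹ = (w ^ n)⁻¹ * c := by
        rw [eq_inv_mul_iff_mul_eq, ← mul_assoc]; exact hc.symm
      have e3 : w ^ n * a = a⁻¹ * c * a * w ^ n := hr.symm
      calc a * (c * ((w ^ n)⁻¹ * a * w ^ n)) = a * c * (w ^ n)⁻¹ * a * w ^ n := by group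
        _ = c * (q * (w ^ n)⁻¹) * a * w ^ n := by rw [e1]; group
        _ = c * (w ^ n)⁻¹ * a * (a⁻¹ * c * a * w ^ n) := by rw [e2]; group
        _ = c * ((w ^ n)⁻¹ * a * w ^ n) * a := by rw [← e3]; group
    have h2 : Commute a (c * ((w ^ n)⁻¹ * a * w ^ n)) := h1
    rw [hρl]
    exact ((Commute.refl a).zpow_right _ |>.mul_right h2).mul_right
      ((Commute.refl a).zpow_right _)
  -- The upper right entry of `a` is `1`, so the upper left entry of the commutation relation
  -- isolates the lower left entry of the longitude, even when `M = ±1`.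
  have hl10 : ρ (twistKnot n).longitude 1 0 = 0 := by
    have e := congrFun (congrFun (congrArg Subtype.val hcomm) 0) 0
    simp only [Matrix.SpecialLinearGroup.coe_mul] at e
    rw [hae] at e
    simp [Matrix.mul_apply, Fin.sum_univ_two] at e
    linear_combination e
  have hl := (riley_eq_zero_of_relation hq ha hc hρl hM hu hae hce hl10 rfl).2
  refine ⟨ρ, ⟨(twistKnot n).meridian, g, ?_⟩, hl10, by rw [hρm, hae]; simp, ?_,
    by rw [hρm, hae]; simp⟩
  · rw [hρm, hg]
    intro h
    have e := congrFun (congrFun (congrArg Subtype.val h) 0) 0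
    simp only [Matrix.SpecialLinearGroup.coe_mul] at e
    rw [hae, hce] at e
    simp at e
    exact hu e
  · rw [one_mul] at hl
    exact mul_right_cancel₀ hu' (hl.trans hL.symm)

/-! ### Linear recursions: from the Riley polynomial to the A-polynomial. -/

section Recursion

variable {R S : Type*} [CommRing R] [CommRing S]

/-- The sequence that starts with `x`, `y` and satisfies `a (k + 2) = T * a (k + 1) - P * a k`. -/
def linRec (T P x y : R) : ℕ → R
  | 0 => x
  | 1 => y
  | k + 2 => T * linRec T P x y (k + 1) - P * linRec T P x y k

theorem map_linRec (f : R →+* S) (T P x y : R) (k : ℕ) :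
    f (linRec T P x y k) = linRec (f T) (f P) (f x) (f y) k := by
  induction k using Nat.twoStepInduction with
  | zero => rfl
  | one => rfl
  | more k h1 h2 => simp [linRec, h1, h2]

/-- Multiplying the `k`-th term by `P ^ k` homogenizes a Chebyshev recursion; it is applied with `P
= M² (1 + L M²)²`, the denominator of the trace of `w`. -/
theorem linRec_scale (e P τ x y : R) (k : ℕ) :
    linRec (P * τ) (P ^ 2) (e * x) (e * P * y) k = e * P ^ k * linRec τ 1 x y k := by
  induction k using Nat.twoStepInduction with
  | zero => simp [linRec]
  | one => simp [linRec]
  | more k h1 h2 => simp only [linRec, h1, h2]; ring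

theorem linRec_eq_of_rec {T P : R} (a : ℕ → R) (h : ∀ k, a (k + 2) = T * a (k + 1) - P * a k)
    (k : ℕ) : a k = linRec T P (a 0) (a 1) k := by
  induction k using Nat.twoStepInduction with
  | zero => rfl
  | one => rfl
  | more k h1 h2 => rw [h, h1, h2]; rfl

open Polynomial in
theorem linRec_monic [Nontrivial R] {T x y : R[X]} {d : ℕ} (hT : T.Monic) (hT2 : T.natDegree = 2)
    (hx : x.Monic) (hxd : x.natDegree = d) (hy : y.Monic) (hyd : y.natDegree = d + 2) (k : ℕ) :
    (linRec T 1 x y k).Monic ∧ (linRec T 1 x y k).natDegree = d + 2 * k := by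
  induction k using Nat.twoStepInduction with
  | zero => exact ⟨hx, hxd⟩
  | one => exact ⟨hy, hyd⟩
  | more k h1 h2 =>
    have hm := hT.mul h2.1
    have hd := hT.natDegree_mul h2.1
    rw [hT2, h2.2] at hd
    have hlt : (1 * linRec T 1 x y k).natDegree < (T * linRec T 1 x y (k + 1)).natDegree := by
      rw [one_mul, hd, h1.2]; omega
    simp only [linRec]
    refine ⟨hm.sub_of_left (degree_lt_degree hlt), ?_⟩
    rw [natDegree_sub_eq_left_of_natDegree_lt hlt, hd]
    ring

/-- The Riley polynomial up to sign, monic in `u`. -/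
def rileyMonic (n : ℤ) (u z : R) : R :=
  match n with
  | Int.ofNat k => linRec (2 + u * (u + 2 - z)) 1 1 (2 + u * (u + 2 - z) + (u + 1 - z)) k
  | Int.negSucc k =>
    linRec (2 + u * (u + 2 - z)) 1 (u + 1 - z) ((2 + u * (u + 2 - z)) * (u + 1 - z) + 1) k

/-- The degree in `u` of the Riley polynomial. -/
def rileyDegree : ℤ → ℕ
  | Int.ofNat k => 2 * k
  | Int.negSucc k => 2 * k + 1

theorem map_rileyMonic (f : R →+* S) (n : ℤ) (u z : R) :
    f (rileyMonic n u z) = rileyMonic n (f u) (f z) := by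
  have h2 : f 2 = 2 := map_ofNat f 2
  cases n <;> simp [rileyMonic, map_linRec, h2]

open Polynomial in
theorem rileyMonic_monic [Nontrivial R] (n : ℤ) (z : R) :
    (rileyMonic n (Polynomial.X : R[X]) (Polynomial.C z)).Monic ∧
      (rileyMonic n (Polynomial.X : R[X]) (Polynomial.C z)).natDegree = rileyDegree n := by
  have hτ : (2 + Polynomial.X * (Polynomial.X + 2 - Polynomial.C z) : R[X]) =
      Polynomial.X ^ 2 + (Polynomial.C (2 - z) * Polynomial.X + Polynomial.C 2) := by
    simp only [map_sub, Polynomial.C_ofNat]; ring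
  have hτl : (Polynomial.C (2 - z) * Polynomial.X + Polynomial.C 2 : R[X]).degree <
      (Polynomial.X ^ 2 : R[X]).degree := by
    rw [degree_X_pow]; exact degree_linear_le.trans_lt (by norm_num)
  have hτm : (2 + Polynomial.X * (Polynomial.X + 2 - Polynomial.C z) : R[X]).Monic := by
    rw [hτ]; exact (monic_X_pow 2).add_of_left hτl
  have hτd : (2 + Polynomial.X * (Polynomial.X + 2 - Polynomial.C z) : R[X]).natDegree = 2 := by
    rw [hτ, natDegree_add_eq_left_of_degree_lt hτl, natDegree_X_pow]
  have hg : (Polynomial.X + 1 - Polynomial.C z : R[X]) = Polynomial.X + Polynomial.C (1 - z) := by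
    simp only [map_sub, Polynomial.C_1]; ring
  have hgm : (Polynomial.X + 1 - Polynomial.C z : R[X]).Monic := by
    rw [hg]; exact Polynomial.monic_X_add_C _
  have hgd : (Polynomial.X + 1 - Polynomial.C z : R[X]).natDegree = 1 := by
    rw [hg]; exact Polynomial.natDegree_X_add_C _
  cases n with
  | ofNat k =>
    have hl : (Polynomial.X + 1 - Polynomial.C z : R[X]).natDegree <
        (2 + Polynomial.X * (Polynomial.X + 2 - Polynomial.C z) : R[X]).natDegree := by
      omega
    simpa [rileyMonic, rileyDegree] using linRec_monic (d := 0) hτm hτd monic_one natDegree_one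
      (hτm.add_of_left (degree_lt_degree hl))
      (by rw [natDegree_add_eq_left_of_natDegree_lt hl, hτd]) k
  | negSucc k =>
    have hmm := hτm.mul hgm
    have hmd := hτm.natDegree_mul hgm
    have hl : (1 : R[X]).natDegree <
        ((2 + Polynomial.X * (Polynomial.X + 2 - Polynomial.C z)) *
          (Polynomial.X + 1 - Polynomial.C z) : R[X]).natDegree := by
      rw [natDegree_one]; omega
    have := linRec_monic (d := 1) hτm hτd hgm hgd
      (hmm.add_of_left (degree_lt_degree hl))
      (by rw [natDegree_add_eq_left_of_natDegree_lt hl]; omega) k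
    rw [add_comm 1] at this
    exact this

/-- The A-polynomial of the twist knot, as a function of `L` and `M` in any commutative ring. -/
def aPoly (n : ℤ) (l m : R) : R :=
  match n with
  | Int.ofNat k =>
    linRec (1 - l + 2 * l * m ^ 2 + m ^ 4 + 2 * l * m ^ 4 + l ^ 2 * m ^ 4 + 2 * l * m ^ 6
        - l * m ^ 8 + l ^ 2 * m ^ 8)
      (m ^ 4 * (1 + l * m ^ 2) ^ 4) (-1)
      (l - l * m ^ 2 - m ^ 4 - 2 * l * m ^ 4 - l ^ 2 * m ^ 4 - l * m ^ 6 + l * m ^ 8) k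
  | Int.negSucc k =>
    linRec (1 - l + 2 * l * m ^ 2 + m ^ 4 + 2 * l * m ^ 4 + l ^ 2 * m ^ 4 + 2 * l * m ^ 6
        - l * m ^ 8 + l ^ 2 * m ^ 8)
      (m ^ 4 * (1 + l * m ^ 2) ^ 4) (1 + l * m ^ 6)
      (1 - l + 2 * l * m ^ 2 + 2 * l * m ^ 4 + l ^ 2 * m ^ 4 - l ^ 2 * m ^ 6 - l * m ^ 8
          + l * m ^ 10 + 2 * l ^ 2 * m ^ 10 + 2 * l ^ 2 * m ^ 12 - l ^ 2 * m ^ 14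
          + l ^ 3 * m ^ 14) k

theorem map_aPoly (f : R →+* S) (n : ℤ) (l m : R) : f (aPoly n l m) = aPoly n (f l) (f m) := by
  have h2 : f 2 = 2 := map_ofNat f 2
  cases n <;> simp [aPoly, map_linRec, h2]

end Recursion

theorem riley_add_two (n : ℤ) (u z : ℂ) :
    riley (n + 2) u z = (2 + u * (u + 2 - z)) * riley (n + 1) u z - riley n u z := by
  have h1 := congrArg (Polynomial.eval (2 + u * (u + 2 - z))) (Polynomial.Chebyshev.S_add_two ℂ n)
  have h2 := congrArg (Polynomial.eval (2 + u * (u + 2 - z)))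
    (Polynomial.Chebyshev.S_add_two ℂ (n - 1))
  simp only [Polynomial.eval_sub, Polynomial.eval_mul, Polynomial.eval_X] at h1 h2
  rw [show n - 1 + 2 = n + 2 - 1 by ring, show n - 1 + 1 = n + 1 - 1 by ring] at h2
  rw [riley, riley, riley, h1, h2]
  ring

/-- Both sides obey the Chebyshev recursion; they are equal for `0 ≤ n` and opposite for `n < 0`. -/
theorem riley_eq_zero_iff (n : ℤ) (u z : ℂ) : riley n u z = 0 ↔ rileyMonic n u z = 0 := by
  cases n with
  | ofNat k =>
    have h := linRec_eq_of_rec (T := 2 + u * (u + 2 - z)) (P := 1) (fun k : ℕ => riley k u z)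
      (fun k => by simpa using riley_add_two k u z) k
    have h0 : riley 0 u z = 1 := by simp [riley]
    have h1 : riley 1 u z = 2 + u * (u + 2 - z) + (u + 1 - z) := by simp [riley]; ring
    simp only [Nat.cast_zero, Nat.cast_one, h0, h1] at h
    rw [rileyMonic, ← h]
    rfl
  | negSucc k =>
    have h := linRec_eq_of_rec (T := 2 + u * (u + 2 - z)) (P := 1)
      (fun k : ℕ => -riley (-k - 1) u z)
      (fun k => by
        have := riley_add_two (-k - 3) u z
        rw [show -(k : ℤ) - 3 + 2 = -k - 1 by ring, show -(k : ℤ) - 3 + 1 = -k - 2 by ring] at this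
        push_cast
        rw [show -((k : ℤ) + 2) - 1 = -k - 3 by ring, show -((k : ℤ) + 1) - 1 = -k - 2 by ring,
          this]
        ring) k
    have h0 : riley (-1) u z = z - 1 - u := by simp [riley]
    have h1 : riley (-2) u z = (2 + u * (u + 2 - z)) * (z - 1 - u) - 1 := by
      have := riley_add_two (-2) u z
      norm_num at this
      rw [h0] at this
      have h2 : riley 0 u z = 1 := by simp [riley]
      rw [h2] at this
      linear_combination this
    simp only [Nat.cast_zero, Nat.cast_one, neg_zero, zero_sub] at h
    norm_num at h
    rw [h0, h1] at h
    rw [rileyMonic, show (2 + u * (u + 2 - z)) * (u + 1 - z) + 1 =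
      1 - (2 + u * (u + 2 - z)) * (z - 1 - u) by ring, show u + 1 - z = 1 + u - z by ring]
    have h3 : linRec (2 + u * (u + 2 - z)) 1 (1 + u - z)
      (1 - (2 + u * (u + 2 - z)) * (z - 1 - u)) k = -riley (Int.negSucc k) u z := by
      rw [Int.negSucc_eq, neg_add, ← sub_eq_add_neg, h]
      rw [neg_sub, neg_sub, show u - (z - 1) = 1 + u - z by ring]
    rw [h3, neg_eq_zero]

/-- At `z = -2` the Riley polynomial is that of the dihedral representations. -/
theorem rileyMonic_dihedral (n : ℤ) {s : ℂ} (hs : s ≠ 0) :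
    (s - 1) * s ^ rileyDegree n * rileyMonic n (s + s⁻¹ - 2) (-2) =
      s ^ (2 * rileyDegree n + 1) - 1 := by
  -- For `u = s + s⁻¹ - 2` and `z = -2` the trace is `s ^ 2 + s ^ (-2)`, so the solutions of the
  -- recursion are the sums `s ^ (-d) + ⋯ + s ^ d`.
  have hτ : s ^ 2 * (2 + (s + s⁻¹ - 2) * (s + s⁻¹ - 2 + 2 - -2)) = s ^ 4 + 1 := by
    field_simp; ring
  have hg : s * (s + s⁻¹ - 2 + 1 - -2) = s ^ 2 + s + 1 := by
    field_simp; ring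
  have step : ∀ (τ x y : ℂ) (d : ℕ), s ^ 2 * τ = s ^ 4 + 1 →
      (s - 1) * s ^ d * x = s ^ (2 * d + 1) - 1 →
      (s - 1) * s ^ (d + 2) * y = s ^ (2 * d + 5) - 1 → ∀ k,
      (s - 1) * s ^ (2 * k + d) * linRec τ 1 x y k = s ^ (2 * (2 * k + d) + 1) - 1 := by
    intro τ x y d hτ hx hy k
    induction k using Nat.twoStepInduction with
    | zero => simpa [linRec] using hx
    | one =>
      rw [mul_one, add_comm 2, show 2 * (d + 2) + 1 = 2 * d + 5 by ring]
      exact hy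
    | more k h1 h2 =>
      simp only [linRec]
      have e : (s - 1) * s ^ (2 * (k + 2) + d) *
          (τ * linRec τ 1 x y (k + 1) - 1 * linRec τ 1 x y k) =
          (s ^ 2 * τ) * ((s - 1) * s ^ (2 * (k + 1) + d) * linRec τ 1 x y (k + 1)) -
          s ^ 4 * ((s - 1) * s ^ (2 * k + d) * linRec τ 1 x y k) := by ring
      rw [e, h1, h2, hτ]
      ring
  cases n with
  | ofNat k =>
    exact step _ _ _ 0 hτ (by ring) (by linear_combination (s - 1) * hτ + (s - 1) * s * hg) k
  | negSucc k =>
    refine step _ _ _ 1 hτ (by linear_combination (s - 1) * hg) ?_ k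
    linear_combination (s - 1) * (s ^ 2 + s + 1) * hτ +
      (s - 1) * s ^ 2 * (2 + (s + s⁻¹ - 2) * (s + s⁻¹ - 2 + 2 - -2)) * hg

/-- The exponent of `M ^ 2` by which the A-polynomial differs from the homogenized Riley
polynomial. -/
def mExponent : ℤ → ℕ
  | Int.ofNat k => k
  | Int.negSucc k => k + 1

/-- The substituted `u` is the solution of the longitude relation. It suffices to compare the
coefficients of the recursion and two initial terms; `linRec_scale` does the rest. -/
theorem aPoly_eq_rileyMonic (n : ℤ) {l m : ℂ} (hm : m ≠ 0) (hD : 1 + l * m ^ 2 ≠ 0) :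
    aPoly n l m = -((m ^ 2) ^ mExponent n * (1 + l * m ^ 2) ^ rileyDegree n *
      rileyMonic n ((1 - m ^ 2) * (l - 1) / (1 + l * m ^ 2)) (m ^ 2 + (m ^ 2)⁻¹)) := by
  set D := 1 + l * m ^ 2 with hDdef
  set u := (1 - m ^ 2) * (l - 1) / D with hu
  set τ := 2 + u * (u + 2 - (m ^ 2 + (m ^ 2)⁻¹)) with hτ
  set g := u + 1 - (m ^ 2 + (m ^ 2)⁻¹) with hg
  have hP : m ^ 4 * D ^ 4 = (m ^ 2 * D ^ 2) ^ 2 := by ring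
  have huD : u * D = (1 - m ^ 2) * (l - 1) := by rw [hu]; field_simp
  have hmi : m ^ 2 * (m ^ 2)⁻¹ = 1 := mul_inv_cancel₀ (pow_ne_zero _ hm)
  have hgD : m ^ 2 * D * g = -(1 + l * m ^ 6) := by
    rw [hg]
    linear_combination m ^ 2 * huD - D * hmi + (m ^ 2 - 1 - m ^ 4) * hDdef
  have hτD : (1 - l + 2 * l * m ^ 2 + m ^ 4 + 2 * l * m ^ 4 + l ^ 2 * m ^ 4 + 2 * l * m ^ 6
        - l * m ^ 8 + l ^ 2 * m ^ 8) = m ^ 2 * D ^ 2 * τ := by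
    have : m ^ 2 * D ^ 2 * τ = 2 * m ^ 2 * D ^ 2 + m ^ 2 * (u * D) ^ 2 +
        (2 * m ^ 2 - m ^ 4 - m ^ 2 * (m ^ 2)⁻¹) * D * (u * D) := by rw [hτ]; ring
    rw [this, huD, hmi, hDdef]
    ring
  cases n with
  | ofNat k =>
    have h1 : (l - l * m ^ 2 - m ^ 4 - 2 * l * m ^ 4 - l ^ 2 * m ^ 4 - l * m ^ 6 + l * m ^ 8) =
        -1 * (m ^ 2 * D ^ 2) * (τ + g) := by
      linear_combination -hτD + D * hgD + (1 + l * m ^ 6) * hDdef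
    have := linRec_scale (-1) (m ^ 2 * D ^ 2) τ 1 (τ + g) k
    rw [← hτD, ← hP, ← h1, mul_one] at this
    simp only [aPoly, rileyMonic, rileyDegree, mExponent]
    rw [← hDdef, this, ← hτ, ← hg]
    ring_nf
  | negSucc k =>
    have h0 : 1 + l * m ^ 6 = (-m ^ 2 * D) * g := by linear_combination hgD
    have h1 : (1 - l + 2 * l * m ^ 2 + 2 * l * m ^ 4 + l ^ 2 * m ^ 4 - l ^ 2 * m ^ 6 - l * m ^ 8
          + l * m ^ 10 + 2 * l ^ 2 * m ^ 10 + 2 * l ^ 2 * m ^ 12 - l ^ 2 * m ^ 14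
          + l ^ 3 * m ^ 14) = (-m ^ 2 * D) * (m ^ 2 * D ^ 2) * (τ * g + 1) := by
      have : (-m ^ 2 * D) * (m ^ 2 * D ^ 2) * (τ * g + 1) =
        -(m ^ 2 * D ^ 2 * τ) * (m ^ 2 * D * g) - m ^ 4 * D ^ 3 := by ring
      rw [this, ← hτD, hgD, hDdef]
      ring
    have := linRec_scale (-m ^ 2 * D) (m ^ 2 * D ^ 2) τ g (τ * g + 1) k
    rw [← hτD, ← hP, ← h1, ← h0] at this
    simp only [aPoly, rileyMonic, rileyDegree, mExponent]
    rw [← hDdef, this, ← hτ, ← hg]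
    ring_nf

/-! ### Special values of the A-polynomial. -/

theorem linRec_zero_right (T x y : ℂ) (k : ℕ) : linRec T 0 x y (k + 1) = T ^ k * y := by
  induction k with
  | zero => simp [linRec]
  | succ k ih => simp only [linRec, ih]; ring

/-- This controls the pole of the substitution. Where `1 + l * m ^ 2 = 0` the recursion loses its
last term and becomes geometric, with a ratio that vanishes only if `m ^ 4 = 1`. -/
theorem pow_four_eq_one_of_aPoly {n : ℤ} {l m : ℂ} (hD : 1 + l * m ^ 2 = 0)
    (h : aPoly n l m = 0) : m ^ 4 = 1 := by
  have hP : m ^ 4 * (1 + l * m ^ 2) ^ 4 = 0 := by rw [hD]; ring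
  set T := 1 - l + 2 * l * m ^ 2 + m ^ 4 + 2 * l * m ^ 4 + l ^ 2 * m ^ 4 + 2 * l * m ^ 6
        - l * m ^ 8 + l ^ 2 * m ^ 8 with hT
  have hA : T * m ^ 2 = (1 - m ^ 4) ^ 2 := by
    rw [hT]
    linear_combination ((m ^ 2 + m ^ 6) * (l * m ^ 2) +
      (-1 + m ^ 2 + 2 * m ^ 4 + m ^ 6 - m ^ 8)) * hD
  have hA0 : T = 0 → m ^ 4 = 1 := by
    intro hk
    rw [hk, zero_mul] at hA
    exact (sub_eq_zero.1 (pow_eq_zero_iff two_ne_zero |>.1 hA.symm)).symm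
  have hneg : 1 + l * m ^ 6 = 0 → m ^ 4 = 1 := fun h => by
    linear_combination m ^ 4 * hD - h
  cases n with
  | ofNat k =>
    simp only [aPoly] at h
    rw [hP, ← hT] at h
    cases k with
    | zero => simp [linRec] at h
    | succ k =>
      rw [linRec_zero_right] at h
      rcases mul_eq_zero.1 h with h | h
      · exact hA0 (eq_zero_of_pow_eq_zero h)
      · exact hA0 (by rw [hT]; linear_combination -h + (1 + l * m ^ 6) * hD)
  | negSucc k =>
    simp only [aPoly] at h
    rw [hP, ← hT] at h
    cases k with
    | zero => exact hneg h
    | succ k =>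
      rw [linRec_zero_right] at h
      rcases mul_eq_zero.1 h with h | h
      · exact hA0 (eq_zero_of_pow_eq_zero h)
      · have h' : T * (1 + l * m ^ 6) = 0 := by
          rw [hT]; linear_combination h + m ^ 4 * (1 + l * m ^ 2) ^ 2 * hD
        rcases mul_eq_zero.1 h' with h | h
        · exact hA0 h
        · exact hneg h

/-- At `L = 0` the characteristic roots of the recursion are `1` and `m ^ 4`, and each of the two
sequences follows just one of them. -/
theorem aPoly_zero_left {R : Type*} [CommRing R] (n : ℤ) (m : R) :
    ∃ k, aPoly n 0 m = -(m ^ k) ∨ aPoly n 0 m = 1 := by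
  cases n with
  | ofNat k =>
    have h := linRec_eq_of_rec (T := 1 + m ^ 4) (P := m ^ 4) (fun k => -(m ^ 4) ^ k)
      (fun k => by ring) k
    refine ⟨4 * k, Or.inl ?_⟩
    rw [pow_mul, h]
    simp [aPoly]
  | negSucc k =>
    have h := linRec_eq_of_rec (T := 1 + m ^ 4) (P := m ^ 4) (fun _ => (1 : R))
      (fun k => by ring) k
    refine ⟨0, Or.inr ?_⟩
    rw [h]
    simp [aPoly]

theorem aPoly_two_zero (n : ℤ) : aPoly n (2 : ℂ) 0 ≠ 0 := by
  cases n with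
  | ofNat k =>
    cases k with
    | zero => simp [aPoly, linRec]
    | succ k =>
      simp only [aPoly]
      rw [show (0 : ℂ) ^ 4 * (1 + 2 * 0 ^ 2) ^ 4 = 0 by ring, linRec_zero_right]
      norm_num
  | negSucc k =>
    cases k with
    | zero => simp [aPoly, linRec]
    | succ k =>
      simp only [aPoly]
      rw [show (0 : ℂ) ^ 4 * (1 + 2 * 0 ^ 2) ^ 4 = 0 by ring, linRec_zero_right]
      norm_num

/-- At `L = M = 1` the characteristic root `4` is double, but the initial terms select a purely
geometric sequence. The value shows that `aPoly` is not zero and has no factor `L - 1`. -/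
theorem aPoly_one_one (n : ℤ) : aPoly n (1 : ℂ) 1 ≠ 0 := by
  cases n with
  | ofNat k =>
    have h := linRec_eq_of_rec (T := (8 : ℂ)) (P := 16) (fun k => -4 ^ k) (fun k => by ring) k
    simp only [aPoly]
    norm_num at h ⊢
    rw [← h]
    simp
  | negSucc k =>
    have h := linRec_eq_of_rec (T := (8 : ℂ)) (P := 16) (fun k => 2 * 4 ^ k) (fun k => by ring) k
    simp only [aPoly]
    norm_num at h ⊢
    rw [← h]
    simp

/-- Hence no line `M = const` is a component. At `m = 0` the values `l = 0` and `l = 1` can be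
zeros, whence `l = 2`. -/
theorem exists_aPoly_ne_zero (n : ℤ) (m : ℂ) : ∃ l, aPoly n l m ≠ 0 := by
  rcases eq_or_ne m 0 with rfl | hm
  · exact ⟨2, aPoly_two_zero n⟩
  · obtain ⟨k, h | h⟩ := aPoly_zero_left n m
    · exact ⟨0, by rw [h]; simp [hm]⟩
    · exact ⟨0, by rw [h]; simp⟩

/-! ### Irreducible curves and Zariski closures. -/

section Nullstellensatz

variable {σ K : Type*} [Field K]

theorem dvd_of_forall_eval_eq_zero [IsAlgClosed K] [Finite σ] {f p : MvPolynomial σ K}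
    (hf : Irreducible f)
    (h : ∀ x, eval x f = 0 → eval x p = 0) : f ∣ p := by
  have hprime : (Ideal.span {f}).IsPrime :=
    (Ideal.span_singleton_prime hf.ne_zero).2 hf.prime
  rw [← Ideal.mem_span_singleton,
    ← MvPolynomial.IsPrime.vanishingIdeal_zeroLocus (K := K) (Ideal.span {f})]
  rw [mem_vanishingIdeal_iff]
  intro x hx
  rw [mem_zeroLocus_iff] at hx
  have := hx f (Ideal.mem_span_singleton_self f)
  rw [aeval_eq_eval] at this ⊢
  exact h x this

theorem eval_eq_zero_of_dvd {f p : MvPolynomial σ K} (h : f ∣ p) {x : σ → K}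
    (hx : eval x f = 0) : eval x p = 0 := by
  obtain ⟨q, rfl⟩ := h
  rw [map_mul, hx, zero_mul]

theorem subset_zeroLocus_vanishingIdeal_iff [IsAlgClosed K] [Finite σ]
    {f : MvPolynomial σ K} (hf : Irreducible f)
    (V : Set (σ → K)) :
    {x | eval x f = 0} ⊆ zeroLocus K (vanishingIdeal K V) ↔
      ∀ p : MvPolynomial σ K, (∀ x ∈ V, eval x p = 0) → f ∣ p := by
  constructor
  · intro h p hp
    refine dvd_of_forall_eval_eq_zero hf fun x hx => ?_
    have := mem_zeroLocus_iff.1 (h hx) p (mem_vanishingIdeal_iff.2 fun y hy => by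
      rw [aeval_eq_eval]; exact hp y hy)
    rwa [aeval_eq_eval] at this
  · intro h x hx
    rw [mem_zeroLocus_iff]
    intro p hp
    rw [mem_vanishingIdeal_iff] at hp
    rw [aeval_eq_eval]
    exact eval_eq_zero_of_dvd (h p fun y hy => by
      have := hp y hy
      rwa [aeval_eq_eval] at this) hx

/-- An irreducible polynomial that divides a polynomial in one of the variables is linear. -/
theorem exists_X_sub_C_dvd [IsAlgClosed K] {f : MvPolynomial σ K} (hf : Irreducible f) (i : σ)
    {g : Polynomial K} (hg : g ≠ 0) (h : f ∣ Polynomial.aeval (X i) g) :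
    ∃ a, X i - C a ∣ f := by
  have hs := (IsAlgClosed.splits g).eq_prod_roots
  rw [hs, map_mul, Polynomial.aeval_C, map_multiset_prod, Multiset.map_map] at h
  have hunit : IsUnit (algebraMap K (MvPolynomial σ K) g.leadingCoeff) :=
    (IsUnit.mk0 _ (Polynomial.leadingCoeff_ne_zero.2 hg)).map _
  rw [hunit.dvd_mul_left] at h
  obtain ⟨a, -, hfq⟩ := Prime.exists_mem_multiset_map_dvd hf.prime h
  refine ⟨a, ?_⟩
  simp only [Function.comp_apply, map_sub, Polynomial.aeval_X, Polynomial.aeval_C,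
    algebraMap_eq] at hfq
  obtain ⟨b, hb⟩ := hfq
  have hne : (X i - C a : MvPolynomial σ K) ≠ 0 := by
    intro h0
    have := congrArg (eval fun _ => a + 1) h0
    simp at this
  have hdeg : (X i - C a : MvPolynomial σ K).totalDegree ≤ 1 := by
    refine (totalDegree_sub _ _).trans ?_
    simp
  have hb0 : b ≠ 0 := by rintro rfl; exact hne (by rw [hb, mul_zero])
  have hd := totalDegree_mul_of_isDomain hf.ne_zero hb0
  rw [← hb] at hd
  have hf1 : f.totalDegree ≠ 0 := by
    intro h0
    rw [totalDegree_eq_zero_iff_eq_C] at h0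
    refine hf.not_isUnit ?_
    rw [h0]
    refine (IsUnit.mk0 _ fun h1 => hf.ne_zero ?_).map C
    rw [h0, h1, map_zero]
  have hb1 : b.totalDegree = 0 := by omega
  rw [totalDegree_eq_zero_iff_eq_C] at hb1
  have hbu : IsUnit b := by
    rw [hb1]
    refine (IsUnit.mk0 _ fun h1 => hb0 ?_).map C
    rw [hb1, h1, map_zero]
  rw [hb]
  exact (hbu.mul_right_dvd).2 dvd_rfl

end Nullstellensatz

/-! ### Discriminants and the absence of repeated factors. -/

open Polynomial in
/-- The parameters for which a monic family that is separable at one parameter is not separable are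
the zeros of a nonzero polynomial. -/
theorem exists_discriminant {K : Type*} [Field K] [CharZero K] [IsAlgClosed K]
    {r : Polynomial (Polynomial K)} (hr : r.Monic) (z₀ : K)
    (hsep : ∀ u, (r.map (evalRingHom z₀)).eval u = 0 →
      (derivative (r.map (evalRingHom z₀))).eval u ≠ 0) :
    ∃ g : Polynomial K, g ≠ 0 ∧ ∀ z u, (r.map (evalRingHom z)).eval u = 0 →
      (derivative (r.map (evalRingHom z))).eval u = 0 → g.eval z = 0 := by
  by_cases hd : r.natDegree = 0
  · refine ⟨1, one_ne_zero, fun z u h => ?_⟩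
    rw [eq_one_of_monic_natDegree_zero hr hd] at h
    simp at h
  have hdr : (derivative r).natDegree ≤ r.natDegree - 1 := natDegree_derivative_le r
  refine ⟨resultant r (derivative r) r.natDegree (r.natDegree - 1), ?_, ?_⟩
  · intro h0
    -- `r` is monic and the characteristic is zero, so specialisation keeps both degrees and
    -- commutes with the resultant.
    have h1 := resultant_map_map r (derivative r) r.natDegree (r.natDegree - 1) (evalRingHom z₀)
    have hn : (r.map (evalRingHom z₀)).natDegree = r.natDegree := hr.natDegree_map _
    have hn' : (derivative (r.map (evalRingHom z₀))).natDegree = r.natDegree - 1 := by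
      rw [natDegree_derivative, hn]
    rw [h0, map_zero, ← derivative_map] at h1
    have hco : IsCoprime (r.map (evalRingHom z₀)) (derivative (r.map (evalRingHom z₀))) := by
      rw [isCoprime_iff_aeval_ne_zero_of_isAlgClosed (k := K) K]
      intro u
      by_cases hu : (r.map (evalRingHom z₀)).eval u = 0
      · right; simpa [Polynomial.aeval_def] using hsep u hu
      · left; simpa [Polynomial.aeval_def] using hu
    have h2 := resultant_ne_zero _ _ hco
    rw [hn, hn'] at h2
    exact h2 h1
  · intro z u h h'
    obtain ⟨p, q, -, -, e⟩ := exists_mul_add_mul_eq_C_resultant r (derivative r) le_rfl hdr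
      (Or.inl hd)
    have e2 := congrArg (fun y => (y.map (evalRingHom z)).eval u) e
    simp only [Polynomial.map_add, Polynomial.map_mul, Polynomial.eval_add, Polynomial.eval_mul,
      ← derivative_map, h, h', Polynomial.map_C, Polynomial.eval_C] at e2
    simpa using e2.symm

theorem eval_rileyMonic (n : ℤ) (u z : ℂ) :
    (rileyMonic n Polynomial.X (Polynomial.C z)).eval u = rileyMonic n u z := by
  have := map_rileyMonic (Polynomial.evalRingHom u) n Polynomial.X (Polynomial.C z)
  simpa using this

theorem exists_add_inv_eq (y : ℂ) : ∃ s : ℂ, s ≠ 0 ∧ s + s⁻¹ = y := by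
  obtain ⟨d, hd⟩ := IsAlgClosed.exists_pow_nat_eq (y ^ 2 - 4) (n := 2) (by norm_num)
  have h : (y + d) / 2 * ((y - d) / 2) = 1 := by linear_combination (-1 / 4) * hd
  refine ⟨(y + d) / 2, left_ne_zero_of_mul_eq_one h, ?_⟩
  rw [inv_eq_of_mul_eq_one_right h]
  ring

/-- In the coordinate `s` a double zero would be a multiple zero of `s ^ (2 * d + 1) - 1`, by
`rileyMonic_dihedral`. Working with derivatives in `s` also covers `s = 1`. -/
theorem rileyMonic_separable (n : ℤ) (u : ℂ)
    (h : (rileyMonic n Polynomial.X (Polynomial.C (-2 : ℂ))).eval u = 0) :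
    (Polynomial.derivative (rileyMonic n Polynomial.X (Polynomial.C (-2 : ℂ)))).eval u ≠ 0 := by
  intro h'
  set q := rileyMonic n Polynomial.X (Polynomial.C (-2 : ℂ)) with hq
  obtain ⟨s, hs, hsu⟩ := exists_add_inv_eq (u + 2)
  have hsu' : s + s⁻¹ - 2 = u := by rw [hsu]; ring
  have h1 : HasDerivAt (fun s : ℂ => s + s⁻¹ - 2) (1 + -(s ^ 2)⁻¹) s :=
    ((hasDerivAt_id s).add (hasDerivAt_inv hs)).sub_const 2
  have h2 : HasDerivAt (fun s : ℂ => q.eval (s + s⁻¹ - 2)) 0 s := by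
    have h3 := q.hasDerivAt (s + s⁻¹ - 2)
    rw [hsu', h', ← hsu'] at h3
    have h4 := h3.comp s h1
    rw [zero_mul] at h4
    exact h4
  have h4 : HasDerivAt (fun s : ℂ => (s - 1) * s ^ rileyDegree n) _ s :=
    ((hasDerivAt_id s).sub_const 1).mul (hasDerivAt_pow (rileyDegree n) s)
  have h5 := h4.mul h2
  rw [hsu', h, mul_zero, mul_zero, add_zero] at h5
  have h6 : HasDerivAt (fun s : ℂ => s ^ (2 * rileyDegree n + 1) - 1)
      (((2 * rileyDegree n + 1 : ℕ) : ℂ) * s ^ (2 * rileyDegree n)) s :=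
    (hasDerivAt_pow (2 * rileyDegree n + 1) s).sub_const 1
  have h7 := h5.congr_of_eventuallyEq (f₁ := fun s : ℂ => s ^ (2 * rileyDegree n + 1) - 1) <| by
    filter_upwards [isOpen_ne.mem_nhds hs] with s hs
    rw [← rileyMonic_dihedral n hs, ← eval_rileyMonic]
    rfl
  have h8 := h6.unique h7
  refine mul_ne_zero ?_ (pow_ne_zero _ hs) h8
  exact Nat.cast_ne_zero.2 (Nat.succ_ne_zero _)

theorem exists_rileyMonic_discriminant (n : ℤ) :
    ∃ g : Polynomial ℂ, g ≠ 0 ∧ ∀ z u,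
      (rileyMonic n Polynomial.X (Polynomial.C z)).eval u = 0 →
      (Polynomial.derivative (rileyMonic n Polynomial.X (Polynomial.C z))).eval u = 0 →
      g.eval z = 0 := by
  have hmap : ∀ z : ℂ, (rileyMonic n (Polynomial.X : Polynomial (Polynomial ℂ))
      (Polynomial.C Polynomial.X)).map
      (Polynomial.evalRingHom z) = rileyMonic n Polynomial.X (Polynomial.C z) := by
    intro z
    have := map_rileyMonic (Polynomial.mapRingHom (Polynomial.evalRingHom z)) n Polynomial.X
      (Polynomial.C Polynomial.X)
    simpa using this
  obtain ⟨g, hg, hg'⟩ := exists_discriminant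
    (rileyMonic_monic n (Polynomial.X : Polynomial ℂ)).1 (-2) (fun u h => by
      rw [hmap] at h ⊢; exact rileyMonic_separable n u h)
  refine ⟨g, hg, fun z u h h' => hg' z u ?_ ?_⟩
  · rwa [hmap]
  · rwa [hmap]

/-- Double zeros of the A-polynomial in `L` belong to double zeros of the Riley polynomial. -/
theorem rileyMonic_double_zero {n : ℤ} {l m : ℂ} (hm : m ≠ 0) (hm4 : m ^ 4 ≠ 1)
    (h : (aPoly n Polynomial.X (Polynomial.C m)).eval l = 0)
    (h' : (Polynomial.derivative (aPoly n Polynomial.X (Polynomial.C m))).eval l = 0) :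
    ∃ u, (rileyMonic n Polynomial.X (Polynomial.C (m ^ 2 + (m ^ 2)⁻¹))).eval u = 0 ∧
      (Polynomial.derivative
        (rileyMonic n Polynomial.X (Polynomial.C (m ^ 2 + (m ^ 2)⁻¹)))).eval u = 0 := by
  have heval : ∀ l, (aPoly n Polynomial.X (Polynomial.C m)).eval l = aPoly n l m := fun l => by
    simpa using map_aPoly (Polynomial.evalRingHom l) n Polynomial.X (Polynomial.C m)
  set P := aPoly n Polynomial.X (Polynomial.C m) with hP
  have hD : 1 + l * m ^ 2 ≠ 0 := fun hD =>
    hm4 (pow_four_eq_one_of_aPoly hD (by rw [← heval]; exact h))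
  set q := rileyMonic n Polynomial.X (Polynomial.C (m ^ 2 + (m ^ 2)⁻¹)) with hq
  set u := (1 - m ^ 2) * (l - 1) / (1 + l * m ^ 2) with hu
  have hq0 : q.eval u = 0 := by
    have h1 := heval l
    rw [h, aPoly_eq_rileyMonic n hm hD, ← eval_rileyMonic, eq_comm, neg_eq_zero] at h1
    exact (mul_eq_zero.1 h1).resolve_left
      (mul_ne_zero (pow_ne_zero _ (pow_ne_zero _ hm)) (pow_ne_zero _ hD))
  refine ⟨u, hq0, ?_⟩
  -- The Möbius map from `l` to `u` has nonzero derivative when `m ^ 4 ≠ 1`, so a double zero in `l`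
  -- is one in `u`.
  have h1 : HasDerivAt (fun l : ℂ => (1 - m ^ 2) * (l - 1) / (1 + l * m ^ 2))
      ((1 - m ^ 4) / (1 + l * m ^ 2) ^ 2) l := by
    have h2 : HasDerivAt (fun l : ℂ => (1 - m ^ 2) * (l - 1)) (1 - m ^ 2) l := by
      simpa using ((hasDerivAt_id l).sub_const 1).const_mul (1 - m ^ 2)
    have h3 : HasDerivAt (fun l : ℂ => 1 + l * m ^ 2) (m ^ 2) l := by
      simpa using ((hasDerivAt_id l).mul_const (m ^ 2)).const_add 1
    have h4 := h2.div h3 hD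
    rw [show (1 - m ^ 2) * (1 + l * m ^ 2) - (1 - m ^ 2) * (l - 1) * m ^ 2 = 1 - m ^ 4 by ring]
      at h4
    exact h4
  have h2 := (q.hasDerivAt u).comp l h1
  have h3 : HasDerivAt (fun l : ℂ => (m ^ 2) ^ mExponent n * (1 + l * m ^ 2) ^ rileyDegree n) _ l :=
    DifferentiableAt.hasDerivAt (by fun_prop)
  have h4 := (h3.mul h2).neg
  simp only [Function.comp_apply] at h4
  rw [← hu, hq0, mul_zero, zero_add] at h4
  have h5 := h4.congr_of_eventuallyEq (f₁ := fun l : ℂ => P.eval l) <| by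
    have hopen : IsOpen {l : ℂ | 1 + l * m ^ 2 ≠ 0} :=
      isOpen_ne_fun (by fun_prop) (by fun_prop)
    filter_upwards [hopen.mem_nhds hD] with l hl
    rw [heval, aPoly_eq_rileyMonic n hm hl, ← eval_rileyMonic]
    rfl
  have h6 := (P.hasDerivAt l).unique h5
  rw [h', eq_comm, neg_eq_zero] at h6
  have h7 := (mul_eq_zero.1 h6).resolve_left
    (mul_ne_zero (pow_ne_zero _ (pow_ne_zero _ hm)) (pow_ne_zero _ hD))
  refine (mul_eq_zero.1 h7).resolve_right (div_ne_zero ?_ (pow_ne_zero _ hD))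
  exact fun h => hm4 (sub_eq_zero.1 h).symm

theorem eval_aPoly (n : ℤ) (x : Fin 2 → ℂ) :
    eval x (aPoly n (X 0) (X 1) : MvPolynomial (Fin 2) ℂ) = aPoly n (x 0) (x 1) := by
  simpa using map_aPoly (eval x) n (X 0) (X 1)

theorem eval_aeval_X (i : Fin 2) (g : Polynomial ℂ) (x : Fin 2 → ℂ) :
    eval x (Polynomial.aeval (X i : MvPolynomial (Fin 2) ℂ) g) = g.eval (x i) := by
  rw [← aeval_eq_eval, ← Polynomial.aeval_algHom_apply]
  simp [Polynomial.aeval_def, Polynomial.eval₂_eq_eval_map]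

theorem not_dvd_aPoly_of_dvd_aeval {n : ℤ} {f : MvPolynomial (Fin 2) ℂ} (hf : Irreducible f)
    {g : Polynomial ℂ} (hg : g ≠ 0) (h : f ∣ Polynomial.aeval (X 1) g) :
    ¬ f ∣ aPoly n (X 0) (X 1) := by
  intro hA
  obtain ⟨a, ha⟩ := exists_X_sub_C_dvd hf 1 hg h
  obtain ⟨l, hl⟩ := exists_aPoly_ne_zero n a
  apply hl
  have := eval_eq_zero_of_dvd (ha.trans hA) (x := ![l, a]) (by simp)
  rw [eval_aPoly] at this
  simpa using this

theorem squarefree_aPoly (n : ℤ) :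
    Squarefree (aPoly n (X 0) (X 1) : MvPolynomial (Fin 2) ℂ) := by
  have hne : (aPoly n (X 0) (X 1) : MvPolynomial (Fin 2) ℂ) ≠ 0 := by
    intro h
    have := eval_aPoly n ![1, 1]
    rw [h, map_zero] at this
    exact aPoly_one_one n (by simpa using this.symm)
  rw [squarefree_iff_irreducible_sq_not_dvd_of_ne_zero hne]
  intro f hf hff
  obtain ⟨g, hg, hdisc⟩ := exists_rileyMonic_discriminant n
  -- The excluded values of `M`: those where the substitution may degenerate, and those where `M ^ 2
  -- + M ^ (-2)` is a root `ζ` of the discriminant. A repeated factor `f` vanishes only over them,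
  -- so it divides `B(M)` and is a line `M = const`.
  let B : Polynomial ℂ := Polynomial.X * (Polynomial.X ^ 4 - 1) *
    ∏ ζ ∈ g.roots.toFinset, (Polynomial.X ^ 4 + 1 - Polynomial.C ζ * Polynomial.X ^ 2)
  have hB : B ≠ 0 := by
    refine mul_ne_zero (mul_ne_zero Polynomial.X_ne_zero ?_) (Finset.prod_ne_zero_iff.2 ?_)
    · intro h
      have := congrArg (Polynomial.eval 0) h
      simp at this
    · intro ζ _ h
      have := congrArg (Polynomial.eval 0) h
      simp at this
  refine not_dvd_aPoly_of_dvd_aeval (n := n) hf hB ?_ (dvd_of_mul_left_dvd hff)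
  refine dvd_of_forall_eval_eq_zero hf fun x hx => ?_
  rw [eval_aeval_X]
  simp only [B, Polynomial.eval_mul, Polynomial.eval_X, Polynomial.eval_sub, Polynomial.eval_pow,
    Polynomial.eval_one, Polynomial.eval_prod, Polynomial.eval_add, Polynomial.eval_C]
  by_cases hm : x 1 = 0
  · simp [hm]
  by_cases hm4 : x 1 ^ 4 = 1
  · simp [hm4]
  obtain ⟨r, hr⟩ := hff
  -- Restriction to the line `M = x 1`, where the square of `f` produces a double zero at `L = x 0`.
  let φ : MvPolynomial (Fin 2) ℂ →ₐ[ℂ] Polynomial ℂ :=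
    aeval ![Polynomial.X, Polynomial.C (x 1)]
  have hφ : aPoly n Polynomial.X (Polynomial.C (x 1)) = φ f * φ f * φ r := by
    rw [← map_mul, ← map_mul, ← hr]
    have := map_aPoly φ.toRingHom n (X 0) (X 1)
    simpa [φ] using this.symm
  have hφf : (φ f).eval (x 0) = 0 := by
    have : (Polynomial.evalRingHom (x 0)).comp φ.toRingHom = eval x := by
      ext i
      · simp [φ]
      · fin_cases i <;> simp [φ]
    have h := congrArg (fun ψ : MvPolynomial (Fin 2) ℂ →+* ℂ => ψ f) this
    simpa [hx] using h
  obtain ⟨u, hu, hu'⟩ := rileyMonic_double_zero (n := n) (l := x 0) hm hm4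
    (by rw [hφ]; simp [hφf]) (by rw [hφ]; simp [hφf])
  have hz := hdisc _ u hu hu'
  rw [Finset.prod_eq_zero (i := x 1 ^ 2 + (x 1 ^ 2)⁻¹) _ _, mul_zero]
  · simpa using ⟨hg, hz⟩
  · have : x 1 ^ 2 * (x 1 ^ 2)⁻¹ = 1 := mul_inv_cancel₀ (pow_ne_zero _ hm)
    linear_combination -this

/-! ### Primitivity and comparison with the eigenvalue variety. -/

theorem primitive_aPoly (n : ℤ) (c : ℤ) (h : C c ∣ (aPoly n L M)) : IsUnit c := by
  obtain ⟨q, hq⟩ := h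
  have h1 := congrArg (eval ![0, 1]) hq
  have h2 : eval ![0, 1] (aPoly n L M) = aPoly n (0 : ℤ) 1 := by
    simpa using map_aPoly (eval ![0, 1]) n L M
  rw [h2, map_mul, eval_C] at h1
  obtain ⟨k, hk | hk⟩ := aPoly_zero_left n (1 : ℤ)
  · rw [hk, one_pow] at h1
    exact isUnit_of_dvd_unit ⟨_, h1⟩ (by simp)
  · rw [hk] at h1
    exact isUnit_of_dvd_unit ⟨_, h1⟩ (by simp)

/-- A zero of `aPoly` with `M ≠ 0`, `M ^ 4 ≠ 1` and `L ≠ 1` comes from a representation. Multiplying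
`p` by `M (M ^ 4 - 1) (L - 1)` takes care of the other points, and no component of `aPoly` divides
that factor. -/
theorem dvd_of_dvd_aPoly {n : ℤ} {f p : MvPolynomial (Fin 2) ℂ} (hf : Irreducible f)
    (hA : f ∣ aPoly n (X 0) (X 1)) (hp : ∀ x ∈ (twistKnot n).eigenvaluePairs, eval x p = 0) :
    f ∣ p := by
  have key : f ∣ p * (Polynomial.aeval (X 1)
      (Polynomial.X * (Polynomial.X ^ 4 - 1) : Polynomial ℂ) *
      Polynomial.aeval (X 0) (Polynomial.X - Polynomial.C 1 : Polynomial ℂ)) := by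
    refine dvd_of_forall_eval_eq_zero hf fun x hx => ?_
    have hAx := eval_eq_zero_of_dvd hA hx
    rw [eval_aPoly] at hAx
    rw [map_mul, map_mul, eval_aeval_X, eval_aeval_X]
    simp only [Polynomial.eval_mul, Polynomial.eval_X, Polynomial.eval_sub, Polynomial.eval_pow,
      Polynomial.eval_one, Polynomial.eval_C]
    by_cases hm : x 1 = 0
    · simp [hm]
    by_cases hm4 : x 1 ^ 4 = 1
    · simp [hm4]
    by_cases hl : x 0 = 1
    · simp [hl]
    rw [hp x, zero_mul]
    have hD : 1 + x 0 * x 1 ^ 2 ≠ 0 := fun hD => hm4 (pow_four_eq_one_of_aPoly hD hAx)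
    have hm2 : 1 - x 1 ^ 2 ≠ 0 := fun h => hm4 (by linear_combination -(1 + x 1 ^ 2) * h)
    rw [aPoly_eq_rileyMonic n hm hD, neg_eq_zero] at hAx
    have hR := (mul_eq_zero.1 hAx).resolve_left
      (mul_ne_zero (pow_ne_zero _ (pow_ne_zero _ hm)) (pow_ne_zero _ hD))
    set u := (1 - x 1 ^ 2) * (x 0 - 1) / (1 + x 0 * x 1 ^ 2) with hu
    have huD : u * (1 + x 0 * x 1 ^ 2) = (1 - x 1 ^ 2) * (x 0 - 1) := div_mul_cancel₀ _ hD
    have hx2 : x = ![x 0, x 1] := by ext i; fin_cases i <;> rfl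
    rw [hx2]
    refine mem_eigenvaluePairs (m := (x 1)⁻¹) (u := u) (mul_inv_cancel₀ hm)
      (div_ne_zero (mul_ne_zero hm2 (sub_ne_zero.2 hl)) hD)
      (by rw [riley_eq_zero_iff, inv_pow]; exact hR) ?_ (by linear_combination -huD)
    intro h
    refine hm4 ?_
    have : (1 - x 1 ^ 2 - u * x 1 ^ 2) * (1 + x 0 * x 1 ^ 2) = 1 - x 1 ^ 4 := by
      linear_combination -(x 1 ^ 2) * huD
    rw [h, zero_mul] at this
    linear_combination this
  rcases hf.prime.dvd_or_dvd key with h | h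
  · exact h
  exfalso
  rcases hf.prime.dvd_or_dvd h with h | h
  · refine not_dvd_aPoly_of_dvd_aeval hf (mul_ne_zero Polynomial.X_ne_zero fun h => ?_) h hA
    have := congrArg (Polynomial.eval 0) h
    simp at this
  · obtain ⟨a, ha⟩ := exists_X_sub_C_dvd hf 0 (Polynomial.X_sub_C_ne_zero 1) h
    have h1 := eval_eq_zero_of_dvd (ha.trans h) (x := ![a, 1]) (by simp)
    rw [eval_aeval_X] at h1
    have ha1 : a = 1 := by simpa [sub_eq_zero] using h1
    have h2 := eval_eq_zero_of_dvd (ha.trans hA) (x := ![1, 1]) (by simp [ha1])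
    rw [eval_aPoly] at h2
    exact aPoly_one_one n (by simpa using h2)

/-- The representations whose eigenvalues do not lie on the zero locus of the A-polynomial
have their eigenvalues in a finite set. -/
theorem exceptional_of_mem_eigenvaluePairs {n : ℤ} {x : Fin 2 → ℂ}
    (hx : x ∈ (twistKnot n).eigenvaluePairs) (hA : aPoly n (x 0) (x 1) ≠ 0) :
    x 0 ^ 2 = 1 ∧ (x 1 ^ 4 - 1) * (n * (x 1 ^ 2 - 1) ^ 2 - x 1 ^ 2) = 0 := by
  obtain ⟨m, hM, ⟨h1, h2⟩ | ⟨u, hR, hL⟩⟩ := of_mem_eigenvaluePairs hx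
  · refine ⟨by rw [h2]; ring, ?_⟩
    have : n * (x 1 ^ 2 - 1) ^ 2 - x 1 ^ 2 = 0 := by
      linear_combination x 1 ^ 2 * h1 - n * (x 1 * m + 1) * hM
    rw [this, mul_zero]
  · have hm : x 1 ≠ 0 := left_ne_zero_of_mul_eq_one hM
    by_cases hm4 : x 1 ^ 4 = 1
    · refine ⟨?_, by rw [hm4]; ring⟩
      have h2 : (x 1 ^ 2 - 1) * (x 1 ^ 2 + 1) = 0 := by linear_combination hm4
      have hm2 : m ^ 2 = x 1 ^ 2 := by
        linear_combination (-m ^ 2) * hm4 + x 1 ^ 2 * (x 1 * m + 1) * hM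
      rw [hm2] at hR
      rcases mul_eq_zero.1 h2 with h | h
      · have ht : x 1 ^ 2 = 1 := by linear_combination h
        rw [ht] at hR hL
        -- At `u = 0`, `z = 2` the Riley polynomial is `(n + 1) - n = 1`.
        have hu : u ≠ 0 := by
          rintro rfl
          norm_num [riley, Polynomial.Chebyshev.S_eval_two] at hR
        have : x 0 = -1 := mul_right_cancel₀ hu (by linear_combination -hL)
        rw [this]; ring
      · have ht : x 1 ^ 2 = -1 := by linear_combination h
        rw [ht] at hR hL
        -- At `u = z = -2` the trace of `w` is `-2` and the Riley polynomial is `±1`.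
        have hu : u + 2 ≠ 0 := by
          intro hu
          have hu2 : u = -2 := by linear_combination hu
          rw [hu2, riley] at hR
          norm_num [Polynomial.Chebyshev.S_eval_neg_two, Int.negOnePow_sub] at hR
          exact pow_ne_zero n.natAbs (neg_ne_zero.2 (one_ne_zero (α := ℂ)))
            (by linear_combination hR)
        have : x 0 = 1 := mul_right_cancel₀ hu (by linear_combination hL)
        rw [this]; ring
    · exfalso
      apply hA
      have hE : (1 + x 0 * x 1 ^ 2) * (1 - x 1 ^ 2 - u * x 1 ^ 2) = 1 - x 1 ^ 4 := by
        linear_combination x 1 ^ 2 * hL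
      have hE0 : (1 + x 0 * x 1 ^ 2) * (1 - x 1 ^ 2 - u * x 1 ^ 2) ≠ 0 := by
        rw [hE]; exact fun h => hm4 (by linear_combination -h)
      have hD := left_ne_zero_of_mul hE0
      have hu : (1 - x 1 ^ 2) * (x 0 - 1) / (1 + x 0 * x 1 ^ 2) = u := by
        rw [div_eq_iff hD]
        linear_combination hL
      rw [aPoly_eq_rileyMonic n hm hD, hu]
      rw [riley_eq_zero_iff, eq_inv_of_mul_eq_one_right hM, inv_pow] at hR
      rw [hR]; ring

/-- The eigenvalue pairs off the zero locus satisfy an equation in `L` alone and one in `M` alone.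
Both products with `aPoly` vanish on all pairs, and no irreducible `f` divides both equations. -/
theorem dvd_aPoly_of_forall {n : ℤ} {f : MvPolynomial (Fin 2) ℂ} (hf : Irreducible f)
    (h : ∀ p : MvPolynomial (Fin 2) ℂ,
      (∀ x ∈ (twistKnot n).eigenvaluePairs, eval x p = 0) → f ∣ p) :
    f ∣ aPoly n (X 0) (X 1) := by
  by_contra hA
  let g : Polynomial ℂ := (Polynomial.X ^ 4 - 1) *
    (Polynomial.C (n : ℂ) * (Polynomial.X ^ 2 - 1) ^ 2 - Polynomial.X ^ 2)
  have hg : g ≠ 0 := by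
    intro h
    -- `g(2) = 15 (9 n - 4)`, which is not zero for an integer `n`.
    have := congrArg (Polynomial.eval 2) h
    simp only [g, Polynomial.eval_mul, Polynomial.eval_X, Polynomial.eval_sub, Polynomial.eval_pow,
      Polynomial.eval_one, Polynomial.eval_C, Polynomial.eval_zero] at this
    norm_num at this
    have h9 : (n : ℤ) * 9 = 4 := by exact_mod_cast sub_eq_zero.1 this
    omega
  have h1 : f ∣ aPoly n (X 0) (X 1) *
      Polynomial.aeval (X 0) (Polynomial.X ^ 2 - 1 : Polynomial ℂ) :=
    h _ fun x hx => by
      rw [map_mul, eval_aPoly, eval_aeval_X]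
      by_cases hA : aPoly n (x 0) (x 1) = 0
      · rw [hA, zero_mul]
      · simp [(exceptional_of_mem_eigenvaluePairs hx hA).1]
  have h2 : f ∣ aPoly n (X 0) (X 1) * Polynomial.aeval (X 1) g :=
    h _ fun x hx => by
      rw [map_mul, eval_aPoly, eval_aeval_X]
      by_cases hA : aPoly n (x 0) (x 1) = 0
      · rw [hA, zero_mul]
      · have := (exceptional_of_mem_eigenvaluePairs hx hA).2
        simp only [g, Polynomial.eval_mul, Polynomial.eval_X, Polynomial.eval_sub,
          Polynomial.eval_pow, Polynomial.eval_one, Polynomial.eval_C]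
        rw [this, mul_zero]
  obtain ⟨a, ha⟩ := exists_X_sub_C_dvd hf 1 hg ((hf.prime.dvd_or_dvd h2).resolve_left hA)
  have h3 := eval_eq_zero_of_dvd (ha.trans ((hf.prime.dvd_or_dvd h1).resolve_left hA))
    (x := ![0, a]) (by simp)
  rw [eval_aeval_X] at h3
  simp at h3

theorem isAPolynomial_aPoly (n : ℤ) : (twistKnot n).IsAPolynomial (aPoly n L M) := by
  have hmap : map (Int.castRingHom ℂ) (aPoly n L M) = aPoly n (X 0) (X 1) := by
    simpa using map_aPoly (map (Int.castRingHom ℂ)) n L M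
  refine ⟨primitive_aPoly n, ?_, fun f hf => ?_⟩
  · rw [hmap]; exact squarefree_aPoly n
  · rw [hmap, eigenvalueVariety, subset_zeroLocus_vanishingIdeal_iff hf]
    exact ⟨fun h p hp => dvd_of_dvd_aPoly hf h hp, dvd_aPoly_of_forall hf⟩

end TwistKnot

/-- `A k` stands for the polynomial `A_k`, for even `k`. -/
theorem theorem1p2 :
    ∃ A : ℤ → MvPolynomial (Fin 2) ℤ,
      (∀ n : ℤ, (twistKnot n).IsAPolynomial (A (2 * n))) ∧
      A (-4) = 1 - L + 2 * L * M ^ 2 + 2 * L * M ^ 4 + L ^ 2 * M ^ 4 - L ^ 2 * M ^ 6 - L * M ^ 8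
          + L * M ^ 10 + 2 * L ^ 2 * M ^ 10 + 2 * L ^ 2 * M ^ 12 - L ^ 2 * M ^ 14
          + L ^ 3 * M ^ 14 ∧
      A (-2) = 1 + L * M ^ 6 ∧
      A 0 = -1 ∧
      A 2 = L - L * M ^ 2 - M ^ 4 - 2 * L * M ^ 4 - L ^ 2 * M ^ 4 - L * M ^ 6 + L * M ^ 8 ∧
      (∀ n : ℤ, 1 < n → A (2 * n) =
        Au * A (2 * (n - 1)) - M ^ 4 * (1 + L * M ^ 2) ^ 4 * A (2 * (n - 2))) ∧
      (∀ n : ℤ, n < -2 → A (2 * n) =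
        Au * A (2 * (n + 1)) - M ^ 4 * (1 + L * M ^ 2) ^ 4 * A (2 * (n + 2))) := by
  have h2 : ∀ n : ℤ, 2 * n / 2 = n := fun n => by omega
  -- Values at odd `k` are irrelevant. Initial conditions and recursions hold by the definition of
  -- `linRec`; the content is `isAPolynomial_aPoly`.
  refine ⟨fun k => aPoly (k / 2) L M, fun n => ?_, rfl, rfl, rfl, rfl, fun n hn => ?_,
    fun n hn => ?_⟩
  · simpa only [h2] using isAPolynomial_aPoly n
  · obtain ⟨k, rfl⟩ : ∃ k : ℕ, n = k + 2 := ⟨(n - 2).toNat, by omega⟩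
    simp only [h2]
    rw [show (k : ℤ) + 2 - 1 = Int.ofNat (k + 1) by simp; ring,
      show (k : ℤ) + 2 - 2 = Int.ofNat k by simp, show (k : ℤ) + 2 = Int.ofNat (k + 2) by simp]
    rfl
  · obtain ⟨k, rfl⟩ : ∃ k : ℕ, n = Int.negSucc (k + 2) := ⟨(-n - 3).toNat, by
      rw [Int.negSucc_eq]; push_cast; omega⟩
    simp only [h2]
    rw [show Int.negSucc (k + 2) + 1 = Int.negSucc (k + 1) by
        simp only [Int.negSucc_eq]; push_cast; ring,
      show Int.negSucc (k + 2) + 2 = Int.negSucc k by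
        simp only [Int.negSucc_eq]; push_cast; ring]
    rfl
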